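/- **Theorem 3.2 (Proof of Yan's Conjecture, extended).** For a finite simple graph $G$ with $m\ge 1$ edges and vertex degrees $(d_i)$, let $I(G)=-\sum_i \frac{d_i}{2m}\log\frac{d_i}{2m}$ be its first degree-based entropy (with $0\log 0=0$), and let $h_1(G)=\sum_i (d_i+1)\log(d_i+1)$. Let $n,m$ be integers with $n-1\le m\le 2n-3$, and call a graph *extremal* if it is connected, has $n$ vertices and $m$ edges, and has minimum entropy $I$ among all connected graphs with $n$ vertices and $m$ edges. Put $a=m-n+1$. 1. Every extremal graph has a universal vertex (a vertex adjacent to all other vertices). Deleting any universal vertex from an extremal graph leaves a graph that has $a$ edges and maximizes $h_1$ among all finite graphs with $a$ edges; up to isolated vertices it is the star $K_{1,a}$ if $a\notin\{3,5,6\}$, $K_3$ if $a=3$, $K_4$ minus an edge or $K_{1,5}$ if $a=5$, and $K_4$ if $a=6$. Conversely, a graph on $n$ vertices is extremal if it has a universal vertex whose deletion leaves a maximizer of $h_1$ among all finite graphs with $a$ edges, and likewise if it has a universal vertex whose deletion leaves, up to isolated vertices, a graph of this list. 2. A graph on $n$ vertices is extremal if and only if its degree sequence is $$\begin{cases} (n-1,m-n+2,2^{m-n+1},1^{2n-m-3})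 & \text{if } n+6\le m\le 2n-3 \text{ or } m\in\{n,n+1,n+3\},\\ (n-1,4^4,1^{n-5}) & \text{if } m=n+5,\\ (n-1,4^2,3^2,1^{n-5})\ \text{ or }\ (n-1,6,2^5,1^{n-7}) & \text{if } m=n+4,\\ (n-1,3^3,1^{n-4}) & \text{if } m=n+2,\\ (n-1,1^{n-1}) & \text{if } m=n-1, \end{cases}$$ where $x^k$ means that the degree $x$ is repeated $k$ times. Each of the listed degree sequences is the degree sequence of an extremal graph; in particular, both sequences listed for $m=n+4$ occur. -/

import Mathlib

namespace DegreeEntropy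

/-- The size of a graph: its number of edges. -/
noncomputable def size {V : Type*} (G : SimpleGraph V) : ℕ := G.edgeSet.ncard

open Classical in
/-- The degree sequence of a finite graph, as a multiset. -/
noncomputable def degreeSequence {V : Type*} [Fintype V] (G : SimpleGraph V) : Multiset ℕ :=
  (Finset.univ : Finset V).val.map fun v => G.degree v

open Classical in
/-- The first degree-based entropy `I(G) = -∑ d/(2m) log (d/(2m))`, where `m` is the size of `G`. -/
noncomputable def entropy {V : Type*} [Fintype V] (G : SimpleGraph V) : ℝ :=
  -∑ v : V, ((G.degree v : ℝ) / (2 * (size G : ℝ))) *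
      Real.log ((G.degree v : ℝ) / (2 * (size G : ℝ)))

/-- `f_c(x) = (x + c) log (x + c)`. -/
noncomputable def f (c x : ℝ) : ℝ := (x + c) * Real.log (x + c)

open Classical in
/-- `h_c(G) = ∑ f_c(d)`, the sum being over the degrees of `G`. -/
noncomputable def h {V : Type*} [Fintype V] (c : ℝ) (G : SimpleGraph V) : ℝ :=
  ∑ v : V, f c (G.degree v)

/-- `G` is a connected graph of size `m` whose entropy is minimum among all connected graphs
of size `m` and of the same order (i.e. on the same vertex set). -/
def IsEntropyMinimizer {V : Type*} [Fintype V] (m : ℕ) (G : SimpleGraph V) : Prop :=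
  G.Connected ∧ size G = m ∧
    ∀ H : SimpleGraph V, H.Connected → size H = m → entropy G ≤ entropy H

/-- `G` has `a` edges and maximizes `h_1` among all finite graphs, of any order, with `a` edges.
(Isolated vertices contribute `f_1(0) = 0`.) -/
def IsH1Maximizer {V : Type*} [Fintype V] (a : ℕ) (G : SimpleGraph V) : Prop :=
  size G = a ∧ ∀ (k : ℕ) (H : SimpleGraph (Fin k)), size H = a → h 1 H ≤ h 1 G

/-- `G` is, up to isomorphism, `H` together with some (possibly no) isolated vertices. -/
def IsUpToIsolated {V W : Type*} (G : SimpleGraph V) (H : SimpleGraph W) : Prop :=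
  ∃ k : ℕ, Nonempty (G ≃g H.sum (⊥ : SimpleGraph (Fin k)))

/-- The star `K_{1,a}`. -/
def star (a : ℕ) : SimpleGraph (Fin 1 ⊕ Fin a) := completeBipartiteGraph (Fin 1) (Fin a)

/-- The graph `K_4` minus an edge. -/
def K4minus : SimpleGraph (Fin 4) := (⊤ : SimpleGraph (Fin 4)).deleteEdges {s(2, 3)}

/-- Up to isolated vertices, `G` is: `K_3` if `a = 3`; `K_4` minus an edge or `K_{1,5}` if `a = 5`;
`K_4` if `a = 6`; and `K_{1,a}` for all other `a`. -/
def IsH1ExtremalForm {V : Type*} (a : ℕ) (G : SimpleGraph V) : Prop :=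
  if a = 3 then IsUpToIsolated G (⊤ : SimpleGraph (Fin 3))
  else if a = 5 then IsUpToIsolated G K4minus ∨ IsUpToIsolated G (star 5)
  else if a = 6 then IsUpToIsolated G (⊤ : SimpleGraph (Fin 4))
  else IsUpToIsolated G (star a)

/-- The list of extremal degree sequences for order `n` and size `m`. No subtraction is truncated
when `n - 1 ≤ m ≤ 2n - 3`. -/
def extremalDegreeSequences (n m : ℕ) : Set (Multiset ℕ) :=
  if m = n + 5 then {{n - 1} + Multiset.replicate 4 4 + Multiset.replicate (n - 5) 1}
  else if m = n + 4 then
    {{n - 1} + Multiset.replicate 2 4 + Multiset.replicate 2 3 + Multiset.replicate (n - 5) 1,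
     {n - 1} + {6} + Multiset.replicate 5 2 + Multiset.replicate (n - 7) 1}
  else if m = n + 2 then {{n - 1} + Multiset.replicate 3 3 + Multiset.replicate (n - 4) 1}
  else if m + 1 = n then {{n - 1} + Multiset.replicate (n - 1) 1}
  else {{n - 1} + {m + 2 - n} + Multiset.replicate (m + 1 - n) 2
          + Multiset.replicate (2 * n - m - 3) 1}

end DegreeEntropy

/-! Put `a = m + 1 - n`. For fixed size, minimum entropy means maximum `h 0`. Let `v` have maximum
degree, let `u` be a neighbour of `v`, and let `w` be adjacent to `u` but not to `v`. Replacing `uw`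
by `vw` preserves connectedness and strictly raises `h 0`, by convexity of `x log x`. So in an
extremal graph the closed neighbourhood of `v` is closed under adjacency, and `v` is universal.
Deleting a universal vertex lowers every other degree by one, whence `h 0 G = f 0 (n - 1) + h 1 (G -
v)`; coning reverses this. What remains is to maximize `h 1` over graphs with `a` edges. The bound
`m ≤ 2n - 3` says that `K_{1,a}` fits on `n - 1` vertices.

That maximum (`starOrSmallOrLess`) is found by strong induction on `a`, removing a vertex of least
positive degree `d`. If `d = 1`, convexity shows that the gain is largest when the edge is attached
to the centre of a star. If `d ≥ 2`, then `d(d + 1) ≤ 2a`, and a Jensen bound (`sum_increment_le`)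
makes the gain smaller than that of the star (`gain_lt`) outside a few small cases. These are
settled by explicit values, and the exceptions `K_3`, `K_4` minus an edge and `K_4` appear there. In
every case of equality the graph is recovered from its edge count and its number of non-isolated
vertices, or from a vertex incident with every edge. -/

namespace DegreeEntropy

/-! ### Logarithmic inequalities. -/

open Real

/-- The left side is 1 plus the mean of `log` over `[x, x + 1]`, which by concavity is at most 1
plus `log` at the midpoint. -/
theorem add_one_mul_log_sub_le {x : ℝ} (hx : 0 < x) :
    (x + 1) * log (x + 1) - x * log x ≤ 1 + log (x + 1 / 2) := by
  have key : ∀ t ∈ Set.Ico (0 : ℝ) 1, (1 + t) * log (1 + t) - (1 - t) * log (1 - t) ≤ 2 * t := by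
    have hd : ∀ t ∈ Set.Ico (0 : ℝ) 1, HasDerivAt
        (fun t : ℝ => 2 * t - ((1 + t) * log (1 + t) - (1 - t) * log (1 - t)))
        (-(log (1 + t) + log (1 - t))) t := by
      intro t ht
      have h1 := (hasDerivAt_mul_log (x := 1 + t) (by linarith [ht.1])).comp t
        ((hasDerivAt_id t).const_add 1)
      have h2 := (hasDerivAt_mul_log (x := 1 - t) (by linarith [ht.2])).comp t
        ((hasDerivAt_id t).const_sub 1)
      have h3 := ((hasDerivAt_id t).const_mul 2).sub (h1.sub h2)
      convert! h3 using 1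
      simp; ring
    have hm : MonotoneOn (fun t : ℝ => 2 * t - ((1 + t) * log (1 + t) - (1 - t) * log (1 - t)))
        (Set.Ico 0 1) := by
      apply monotoneOn_of_deriv_nonneg (convex_Ico 0 1)
      · exact fun t ht => (hd t ht).continuousAt.continuousWithinAt
      · exact fun t ht => (hd t (interior_subset ht)).differentiableAt.differentiableWithinAt
      · intro t ht
        rw [interior_Ico] at ht
        rw [(hd t ⟨ht.1.le, ht.2⟩).deriv, ← log_mul (by linarith [ht.1]) (by linarith [ht.2])]
        have := log_nonpos (x := (1 + t) * (1 - t)) (by nlinarith [ht.1, ht.2])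
          (by nlinarith [ht.1])
        linarith
    intro t ht
    have := hm (by simp) ht ht.1
    simp at this
    linarith
  have hp : (0 : ℝ) < 2 * x + 1 := by linarith
  -- With this `t`, `x + 1` and `x` are `(x + 1/2)(1 + t)` and `(x + 1/2)(1 - t)`.
  have h := key (1 / (2 * x + 1)) ⟨by positivity, by rw [div_lt_one hp]; linarith⟩
  have e1 : 1 + 1 / (2 * x + 1) = (x + 1) / (x + 1 / 2) := by field_simp; ring
  have e2 : 1 - 1 / (2 * x + 1) = x / (x + 1 / 2) := by field_simp; ring
  have hq : (0 : ℝ) < x + 1 / 2 := by linarith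
  rw [e1, e2, log_div (by linarith) hq.ne', log_div hx.ne' hq.ne'] at h
  have h' := mul_le_mul_of_nonneg_right h hq.le
  have e3 : ((x + 1) / (x + 1 / 2) * (log (x + 1) - log (x + 1 / 2)) -
      x / (x + 1 / 2) * (log x - log (x + 1 / 2))) * (x + 1 / 2) =
      (x + 1) * log (x + 1) - x * log x - log (x + 1 / 2) := by field_simp; ring
  have e4 : 2 * (1 / (2 * x + 1)) * (x + 1 / 2) = 1 := by field_simp
  rw [e3, e4] at h'
  linarith

/-- Keeps two terms of the series of `-log (1 - d / x)`, all of whose terms are nonnegative. -/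
theorem le_mul_log_sub {x d : ℝ} (hd : 0 ≤ d) (hdx : d < x) :
    d * log x + d - d ^ 2 / (2 * x) - d ^ 3 / (2 * x ^ 2) ≤
      x * log x - (x - d) * log (x - d) := by
  have hx : 0 < x := by linarith
  have ht : d / x < 1 := by rwa [div_lt_one hx]
  have ht0 : 0 ≤ d / x := by positivity
  have hs := hasSum_pow_div_log_of_abs_lt_one (x := d / x) (by rwa [abs_of_nonneg ht0])
  have h := sum_le_hasSum (Finset.range 2) (fun i _ => by positivity) hs
  simp [Finset.sum_range_succ] at h
  have e : 1 - d / x = (x - d) / x := by field_simp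
  rw [e, log_div (by linarith) hx.ne'] at h
  have h' := mul_le_mul_of_nonneg_right h (show 0 ≤ x - d by linarith)
  have e2 : (d / x + (d / x) ^ 2 / (1 + 1)) * (x - d) =
      d - d ^ 2 / (2 * x) - d ^ 3 / (2 * x ^ 2) := by field_simp; ring
  rw [e2] at h'
  linarith

/-- The value of `h_1` at the star with `a` edges. -/
noncomputable def starValue (a : ℝ) : ℝ := (a + 1) * log (a + 1) + 2 * a * log 2

theorem mul_log_two_lt_log {p q : ℕ} {x : ℝ} (hq : 0 < q)
    (h : (2 : ℝ) ^ p < x ^ q) : p / q * log 2 < log x := by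
  have := log_lt_log (by positivity) h
  rw [log_pow, log_pow] at this
  have hq' : (0 : ℝ) < q := by exact_mod_cast hq
  rw [div_mul_eq_mul_div, div_lt_iff₀ hq']
  linarith

/-- Bound used when a vertex of minimum degree `d` is deleted from a graph with `a` edges. -/
theorem gain_lt_of_reduced {a d : ℝ} (ha : 0 ≤ a) (hd : 0 < d) (hda : d < a + 1)
    (h : log (d + 1) + d * log ((d + 1) / d) + d * log ((2 * a + d ^ 2) / (2 * (a + 1))) +
      d ^ 2 / (2 * (a + 1)) + d ^ 3 / (2 * (a + 1) ^ 2) < 2 * d * log 2) :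
    (d + 1) * log (d + 1) + d * (1 + log ((2 * a + d ^ 2) / (2 * d))) <
      starValue a - starValue (a - d) := by
  have hA : 0 < a + 1 := by linarith
  have h1 := le_mul_log_sub hd.le hda
  have hq : 0 < 2 * a + d ^ 2 := by positivity
  rw [log_div (by linarith) hd.ne', log_div hq.ne' (by linarith),
    log_mul (by norm_num) hA.ne'] at h
  rw [log_div hq.ne' (by linarith), log_mul (by norm_num) hd.ne']
  unfold starValue
  rw [show a - d + 1 = a + 1 - d by ring]
  linarith

/-- The argument of the logarithm is `1 + (d² - 2) / (2(a + 1))`, so every term decreases in `a`;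
for fixed `d` only the least admissible `a` need be checked. -/
theorem reduced_mono {a b d : ℝ} (hd : 0 < d) (hb : 0 < b + 1) (hab : b ≤ a) (hdb : 2 ≤ d ^ 2) :
    d * log ((2 * a + d ^ 2) / (2 * (a + 1))) + d ^ 2 / (2 * (a + 1)) +
      d ^ 3 / (2 * (a + 1) ^ 2) ≤
    d * log ((2 * b + d ^ 2) / (2 * (b + 1))) + d ^ 2 / (2 * (b + 1)) +
      d ^ 3 / (2 * (b + 1) ^ 2) := by
  have ha : 0 < a + 1 := by linarith
  gcongr d * log ?_ + _ / ?_ + _ / ?_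
  · apply div_pos <;> nlinarith
  · rw [div_le_div_iff₀ (by positivity) (by positivity)]
    nlinarith
  · linarith
  · gcongr

/-- The left side bounds what a vertex of degree `d` contributes to `h 1`; the right side is what
`d` further edges contribute to a star. -/
theorem gain_lt {a d : ℕ} (hd : 2 ≤ d) (hda : d * (d + 1) ≤ 2 * a)
    (h67 : 7 ≤ a ∨ d = 2 ∧ 6 ≤ a) :
    ((d : ℝ) + 1) * log (d + 1) + d * (1 + log ((2 * a + d ^ 2) / (2 * d))) <
      starValue a - starValue (a - d) := by
  have hd' : (2 : ℝ) ≤ d := by exact_mod_cast hd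
  have hda' : (d : ℝ) * (d + 1) ≤ 2 * a := by exact_mod_cast hda
  apply gain_lt_of_reduced (by positivity) (by linarith) (by nlinarith)
  have l2 := log_two_gt_d9
  have red : ∀ b : ℝ, 0 < b + 1 → b ≤ a → log ((d : ℝ) + 1) + d * log ((d + 1) / d) +
      (d * log ((2 * b + d ^ 2) / (2 * (b + 1))) + d ^ 2 / (2 * (b + 1)) +
      d ^ 3 / (2 * (b + 1) ^ 2)) < 2 * d * log 2 →
      log ((d : ℝ) + 1) + d * log ((d + 1) / d) + d * log ((2 * a + d ^ 2) / (2 * (a + 1))) +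
      d ^ 2 / (2 * (a + 1)) + d ^ 3 / (2 * (a + 1) ^ 2) < 2 * d * log 2 := by
    intro b hb hab h
    have := reduced_mono (d := d) (by linarith) hb hab (by nlinarith)
    linarith
  -- For large `d` the crude bounds add up to `3 log 2 + (d - 7)/8 + d log 2 + 9/4`, which is below
  -- `2d log 2` from `d = 7` on.
  by_cases h7 : 7 ≤ d
  · have hd7 : (7 : ℝ) ≤ d := by exact_mod_cast h7
    have e1 : log ((d : ℝ) + 1) ≤ 3 * log 2 + (d - 7) / 8 := by
      have h1 := log_le_sub_one_of_pos (x := ((d : ℝ) + 1) / 8) (by positivity)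
      rw [log_div (by positivity) (by norm_num), show (8 : ℝ) = 2 ^ 3 by norm_num, log_pow] at h1
      norm_num at h1
      linarith
    have e2 : (d : ℝ) * log ((d + 1) / d) ≤ 1 := by
      have h1 := log_le_sub_one_of_pos (x := ((d : ℝ) + 1) / d) (by positivity)
      have h2 := mul_le_mul_of_nonneg_left h1 (show (0 : ℝ) ≤ d by positivity)
      have : (d : ℝ) * ((d + 1) / d - 1) = 1 := by field_simp; ring
      linarith
    have e3 : (d : ℝ) * log ((2 * a + d ^ 2) / (2 * (a + 1))) ≤ d * log 2 := by
      gcongr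
      rw [div_le_iff₀ (by positivity)]
      nlinarith
    have e4 : (d : ℝ) ^ 2 / (2 * (a + 1)) ≤ 1 := by
      rw [div_le_one (by positivity)]; nlinarith
    have e5 : (d : ℝ) ^ 3 / (2 * (a + 1) ^ 2) ≤ 1 / 4 := by
      rw [div_le_div_iff₀ (by positivity) (by norm_num)]
      have h1 : ((d : ℝ) * (d + 1)) ^ 2 ≤ (2 * (a + 1)) ^ 2 :=
        pow_le_pow_left₀ (by positivity) (by linarith) 2
      have h2 : 0 ≤ (d : ℝ) ^ 2 * ((d + 1) ^ 2 - 8 * d) := by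
        apply mul_nonneg (by positivity); nlinarith
      nlinarith
    nlinarith
  · have h36 : d = 2 ∨ d = 3 ∨ d = 4 ∨ d = 5 ∨ d = 6 := by omega
    -- Here `b` is the least admissible `a`, and `log x` is the slack left by the logarithmic terms.
    -- It is bounded below by `(p / q) log 2`, so that only rational arithmetic remains.
    have num : ∀ {b : ℕ} {x : ℝ} {p q : ℕ}, b ≤ a → 0 < q → (2 : ℝ) ^ p < x ^ q → 0 < x →
        (d : ℝ) ^ 2 / (2 * (b + 1)) + d ^ 3 / (2 * (b + 1) ^ 2) < p / q * 0.6931471803 →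
        (2 : ℝ) ^ (2 * d) = (d + 1) * ((d + 1) / d) ^ d *
          ((2 * b + d ^ 2) / (2 * (b + 1))) ^ d * x →
        log ((d : ℝ) + 1) + d * log ((d + 1) / d) + d * log ((2 * a + d ^ 2) / (2 * (a + 1))) +
        d ^ 2 / (2 * (a + 1)) + d ^ 3 / (2 * (a + 1) ^ 2) < 2 * d * log 2 := by
      intro b x p q hb hq hpx hx hr e2
      apply red b (by positivity) (by exact_mod_cast hb)
      have e3 := congrArg log e2
      have hd0 : (0 : ℝ) < d := by linarith
      rw [log_mul (by positivity) hx.ne', log_mul (by positivity) (by positivity),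
        log_mul (by positivity) (by positivity), log_pow, log_pow, log_pow] at e3
      push_cast at e3
      have h1 := mul_log_two_lt_log hq hpx
      have h2 : (p : ℝ) / q * 0.6931471803 ≤ p / q * log 2 := by gcongr
      linarith
    rcases h36 with rfl | rfl | rfl | rfl | rfl
    · exact num (b := 6) (p := 4) (q := 5) (x := 16 / (3 * (3 / 2) ^ 2 * (16 / 14) ^ 2))
        (by omega) (by norm_num) (by norm_num) (by norm_num) (by norm_num)
        (by norm_num)
    · exact num (b := 7) (p := 9) (q := 8) (x := 64 / (4 * (4 / 3) ^ 3 * (23 / 16) ^ 3))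
        (by omega) (by norm_num) (by norm_num) (by norm_num) (by norm_num)
        (by norm_num)
    · exact num (b := 10) (p := 3) (q := 2) (x := 256 / (5 * (5 / 4) ^ 4 * (36 / 22) ^ 4))
        (by omega) (by norm_num) (by norm_num) (by norm_num) (by norm_num)
        (by norm_num)
    · exact num (b := 15) (p := 2) (q := 1) (x := 1024 / (6 * (6 / 5) ^ 5 * (55 / 32) ^ 5))
        (by omega) (by norm_num) (by norm_num) (by norm_num) (by norm_num)
        (by norm_num)
    · exact num (b := 21) (p := 2) (q := 1) (x := 4096 / (7 * (7 / 6) ^ 6 * (78 / 44) ^ 6))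
        (by omega) (by norm_num) (by norm_num) (by norm_num) (by norm_num)
        (by norm_num)

end DegreeEntropy

namespace DegreeEntropy

/-! ### The effect of deleting a vertex on `h 1`. -/

section Deletion

open Classical Real Finset

variable {V : Type*} [Fintype V]

theorem size_eq_card_edgeFinset (G : SimpleGraph V) : size G = #G.edgeFinset := by
  rw [size, Set.ncard_eq_toFinset_card']; rfl

theorem sum_degree_eq (G : SimpleGraph V) : ∑ v, G.degree v = 2 * size G := by
  rw [size_eq_card_edgeFinset, G.sum_degrees_eq_twice_card_edges]

theorem f_one_zero : f 1 0 = 0 := by simp [f]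

/-- The non-isolated vertices of a graph. -/
noncomputable def positiveVerts (G : SimpleGraph V) : Finset V := {v | 0 < G.degree v}

theorem mem_positiveVerts {G : SimpleGraph V} {v : V} :
    v ∈ positiveVerts G ↔ 0 < G.degree v := by
  simp [positiveVerts]

theorem sum_positiveVerts_degree (G : SimpleGraph V) :
    ∑ v ∈ positiveVerts G, G.degree v = 2 * size G := by
  rw [← sum_degree_eq]
  refine sum_subset (subset_univ _) fun x _ hx => ?_
  rw [mem_positiveVerts] at hx; omega

theorem h_one_eq_sum_positiveVerts (G : SimpleGraph V) :
    h 1 G = ∑ v ∈ positiveVerts G, f 1 (G.degree v) := by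
  symm
  refine sum_subset (subset_univ _) fun x _ hx => ?_
  rw [mem_positiveVerts] at hx
  rw [show G.degree x = 0 by omega, Nat.cast_zero, f_one_zero]

theorem degree_lt_card_positiveVerts {G : SimpleGraph V} {v : V} (hv : v ∈ positiveVerts G) :
    G.degree v < #(positiveVerts G) := by
  have : G.neighborFinset v ⊆ (positiveVerts G).erase v := by
    intro x hx
    rw [SimpleGraph.mem_neighborFinset] at hx
    rw [mem_erase, mem_positiveVerts, SimpleGraph.degree_pos_iff_exists_adj]
    exact ⟨hx.ne', v, hx.symm⟩
  have h1 := card_le_card this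
  rw [card_erase_of_mem hv, SimpleGraph.card_neighborFinset_eq_degree] at h1
  have := card_pos.2 ⟨v, hv⟩
  omega

theorem two_mul_size_le (G : SimpleGraph V) :
    2 * size G ≤ #(positiveVerts G) * (#(positiveVerts G) - 1) := by
  rw [← sum_positiveVerts_degree, ← smul_eq_mul]
  refine sum_le_card_nsmul _ _ _ fun v hv => ?_
  have := degree_lt_card_positiveVerts hv
  omega

theorem mul_card_positiveVerts_le {G : SimpleGraph V} {d : ℕ}
    (hd : ∀ v ∈ positiveVerts G, d ≤ G.degree v) : #(positiveVerts G) * d ≤ 2 * size G := by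
  rw [← sum_positiveVerts_degree, ← smul_eq_mul]
  exact card_nsmul_le_sum _ _ _ hd

theorem h_one_eq_of_two_degrees {G : SimpleGraph V} {d : ℕ}
    (hd : ∀ v ∈ positiveVerts G, G.degree v = d ∨ G.degree v = d + 1) :
    h 1 G = #(positiveVerts G) * f 1 d +
      (2 * size G - #(positiveVerts G) * d) * (f 1 (d + 1) - f 1 d) := by
  have h1 : ∀ v ∈ positiveVerts G,
      f 1 (G.degree v) = f 1 d + ((G.degree v : ℝ) - d) * (f 1 (d + 1) - f 1 d) := by
    intro v hv
    rcases hd v hv with e | e <;> rw [e] <;> push_cast <;> ring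
  have h2 : (∑ v ∈ positiveVerts G, (G.degree v : ℝ)) = 2 * size G := by
    exact_mod_cast sum_positiveVerts_degree G
  rw [h_one_eq_sum_positiveVerts, sum_congr rfl h1, sum_add_distrib, ← sum_mul, sum_sub_distrib,
    h2]
  simp

theorem h_one_eq_of_regular {G : SimpleGraph V} {d : ℕ}
    (hd : ∀ v ∈ positiveVerts G, d ≤ G.degree v) (hs : #(positiveVerts G) * d = 2 * size G) :
    h 1 G = #(positiveVerts G) * f 1 d := by
  have h1 : ∑ v ∈ positiveVerts G, d = ∑ v ∈ positiveVerts G, G.degree v := by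
    rw [sum_positiveVerts_degree, sum_const, smul_eq_mul, hs]
  have h2 := (sum_eq_sum_iff_of_le hd).1 h1
  rw [h_one_eq_of_two_degrees (d := d) fun v hv => Or.inl (h2 v hv).symm]
  have : (#(positiveVerts G) : ℝ) * d = 2 * size G := by exact_mod_cast hs
  rw [this]; ring

/-- The graph obtained from `G` by deleting all edges at `v`. -/
def isolate (G : SimpleGraph V) (v : V) : SimpleGraph V := G.deleteIncidenceSet v

theorem isolate_adj {V : Type*} {G : SimpleGraph V} {v x y : V} :
    (isolate G v).Adj x y ↔ G.Adj x y ∧ x ≠ v ∧ y ≠ v :=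
  SimpleGraph.deleteIncidenceSet_adj

theorem degree_isolate_self (G : SimpleGraph V) (v : V) :
    (isolate G v).degree v = 0 := by
  rw [SimpleGraph.degree_eq_zero_iff_notMem_support]
  rintro ⟨w, hw⟩
  exact (isolate_adj.1 hw).2.1 rfl

theorem degree_isolate_of_adj {G : SimpleGraph V} {v x : V} (hx : G.Adj v x) :
    G.degree x = (isolate G v).degree x + 1 := by
  have : (isolate G v).neighborFinset x = (G.neighborFinset x).erase v := by
    ext y
    simp only [SimpleGraph.mem_neighborFinset, isolate_adj, mem_erase]
    have := hx.ne'
    tauto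
  rw [← SimpleGraph.card_neighborFinset_eq_degree, ← SimpleGraph.card_neighborFinset_eq_degree,
    this, card_erase_add_one]
  simpa using hx.symm

theorem degree_isolate_of_not_adj {G : SimpleGraph V} {v x : V} (hx : ¬ G.Adj v x)
    (hxv : x ≠ v) : (isolate G v).degree x = G.degree x := by
  have : (isolate G v).neighborFinset x = G.neighborFinset x := by
    ext y
    simp only [SimpleGraph.mem_neighborFinset, isolate_adj]
    refine ⟨fun h => h.1, fun h => ⟨h, hxv, ?_⟩⟩
    rintro rfl
    exact hx h.symm
  rw [← SimpleGraph.card_neighborFinset_eq_degree, ← SimpleGraph.card_neighborFinset_eq_degree,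
    this]

theorem size_isolate (G : SimpleGraph V) (v : V) :
    size (isolate G v) + G.degree v = size G := by
  have h1 := G.card_edgeFinset_deleteIncidenceSet v
  have h2 := G.degree_le_card_edgeFinset v
  rw [size_eq_card_edgeFinset, size_eq_card_edgeFinset]
  have : #(isolate G v).edgeFinset = #G.edgeFinset - G.degree v := by
    rw [← h1]; unfold isolate; convert rfl
  omega

theorem h_one_eq_add_isolate (G : SimpleGraph V) (v : V) :
    h 1 G = h 1 (isolate G v) + f 1 (G.degree v) +
      ∑ x ∈ G.neighborFinset v, (f 1 (G.degree x) - f 1 ((G.degree x : ℝ) - 1)) := by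
  have key : ∀ x, f 1 (G.degree x) = f 1 ((isolate G v).degree x) +
      (if x = v then f 1 (G.degree v) else 0) +
      (if x ∈ G.neighborFinset v then f 1 (G.degree x) - f 1 ((G.degree x : ℝ) - 1) else 0) := by
    intro x
    by_cases hxv : x = v
    · subst hxv
      simp [degree_isolate_self, f_one_zero]
    · by_cases hx : G.Adj v x
      · have := degree_isolate_of_adj hx
        simp [hxv, hx, this]
      · simp [hxv, hx, degree_isolate_of_not_adj hx hxv]
  unfold h
  rw [sum_congr rfl fun x _ => key x, sum_add_distrib, sum_add_distrib,
    sum_ite_mem, univ_inter]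
  simp

/-- The degree sum over `s` counts an edge twice only if both ends lie in `s`, and there are at most
`C(|s|, 2)` such edges. -/
theorem two_mul_sum_degree_le (G : SimpleGraph V) (s : Finset V) :
    2 * ∑ x ∈ s, G.degree x ≤ 2 * size G + #s * (#s - 1) := by
  have h1 : ∀ x, G.degree x = ∑ y, if G.Adj x y then 1 else 0 := by
    intro x
    rw [sum_boole, ← SimpleGraph.card_neighborFinset_eq_degree]
    simp only [Nat.cast_id]
    congr 1; ext; simp
  have h2 : ∑ x ∈ s, G.degree x = ∑ y, ∑ x ∈ s, if G.Adj x y then 1 else 0 := by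
    rw [sum_comm]; exact sum_congr rfl fun x _ => h1 x
  have h3 : ∑ y ∈ s, ∑ x ∈ s, (if G.Adj x y then 1 else 0) ≤ #s * (#s - 1) := by
    rw [← smul_eq_mul]
    refine sum_le_card_nsmul _ _ _ fun y hy => ?_
    rw [sum_boole, ← card_erase_of_mem hy]
    refine card_le_card fun x hx => ?_
    rw [mem_filter] at hx
    exact mem_erase.2 ⟨hx.2.ne, hx.1⟩
  have h4 : ∑ y ∈ sᶜ, ∑ x ∈ s, (if G.Adj x y then 1 else 0) ≤ ∑ y ∈ sᶜ, G.degree y := by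
    refine sum_le_sum fun y _ => ?_
    rw [h1]
    simp only [G.adj_comm y]
    exact sum_le_sum_of_subset (subset_univ s)
  rw [← sum_add_sum_compl s] at h2
  have h5 := sum_add_sum_compl s fun x => G.degree x
  rw [sum_degree_eq] at h5
  omega

theorem f_one_sub_f_one (x : ℝ) : f 1 x - f 1 (x - 1) = (x + 1) * log (x + 1) - x * log x := by
  simp [f]

/-- Jensen for the midpoint bound `1 + log (deg x + 1/2)`, carried out with the tangent line of
`log`. -/
theorem sum_increment_le (G : SimpleGraph V) {v : V} (hv : 0 < G.degree v) :
    ∑ x ∈ G.neighborFinset v, (f 1 (G.degree x) - f 1 ((G.degree x : ℝ) - 1)) ≤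
      G.degree v * (1 + log ((2 * size G + (G.degree v : ℝ) ^ 2) / (2 * G.degree v))) := by
  set d := G.degree v with hd
  have hd0 : (0 : ℝ) < d := by exact_mod_cast hv
  -- An upper bound for the average of `deg x + 1/2` over the neighbours, used as the point of
  -- tangency.
  set c : ℝ := (2 * size G + (d : ℝ) ^ 2) / (2 * d) with hc
  have hc0 : 0 < c := by positivity
  have h1 : ∀ x ∈ G.neighborFinset v, f 1 (G.degree x) - f 1 ((G.degree x : ℝ) - 1) ≤
      log c + ((G.degree x : ℝ) + 1 / 2) / c := by
    intro x hx
    have hx0 : (0 : ℝ) < G.degree x := by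
      rw [SimpleGraph.mem_neighborFinset] at hx
      exact_mod_cast (G.degree_pos_iff_exists_adj x).2 ⟨v, hx.symm⟩
    rw [f_one_sub_f_one]
    have h2 := add_one_mul_log_sub_le hx0
    have h3 := log_le_sub_one_of_pos (x := ((G.degree x : ℝ) + 1 / 2) / c) (by positivity)
    rw [log_div (by positivity) hc0.ne'] at h3
    linarith
  refine (sum_le_sum h1).trans ?_
  rw [sum_add_distrib, ← sum_div, sum_add_distrib, sum_const, sum_const,
    SimpleGraph.card_neighborFinset_eq_degree, ← hd]
  have h4 : 2 * (∑ x ∈ G.neighborFinset v, (G.degree x : ℝ)) ≤ 2 * size G + d * (d - 1) := by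
    have := two_mul_sum_degree_le G (G.neighborFinset v)
    rw [SimpleGraph.card_neighborFinset_eq_degree, ← hd] at this
    have e : ((d - 1 : ℕ) : ℝ) = d - 1 := by rw [Nat.cast_sub hv]; simp
    rw [← e]
    exact_mod_cast this
  have h5 : (∑ x ∈ G.neighborFinset v, (G.degree x : ℝ) + d • (1 / 2 : ℝ)) / c ≤ d := by
    rw [div_le_iff₀ hc0, hc, nsmul_eq_mul]
    have : (d : ℝ) * ((2 * size G + (d : ℝ) ^ 2) / (2 * d)) = (2 * size G + (d : ℝ) ^ 2) / 2 := by
      field_simp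
    rw [this]; linarith
  rw [nsmul_eq_mul]
  linarith

/-- Strict convexity of `x log x` in difference form; it drives both the pendant case and the edge
shift. -/
theorem increment_strictMono {x y : ℝ} (hx : 0 < x) (hxy : x < y) :
    f 1 x - f 1 (x - 1) < f 1 y - f 1 (y - 1) := by
  rw [f_one_sub_f_one, f_one_sub_f_one]
  have hd : ∀ t ∈ Set.Ioi (0 : ℝ), HasDerivAt (fun t => (t + 1) * log (t + 1) - t * log t)
      (log (t + 1) - log t) t := by
    intro t (ht : 0 < t)
    have h1 := (hasDerivAt_mul_log (x := t + 1) (by linarith)).comp t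
      ((hasDerivAt_id t).add_const 1)
    convert! h1.sub (hasDerivAt_mul_log ht.ne') using 1
    simp
  have hm : StrictMonoOn (fun t => (t + 1) * log (t + 1) - t * log t) (Set.Ioi 0) := by
    apply strictMonoOn_of_deriv_pos (convex_Ioi 0)
    · exact fun t ht => (hd t ht).continuousAt.continuousWithinAt
    · intro t ht
      rw [interior_Ioi] at ht
      rw [(hd t ht).deriv, sub_pos]
      exact log_lt_log ht (by linarith)
  exact hm hx (hx.trans hxy) hxy

theorem increment_mono {x y : ℝ} (hx : 0 < x) (hxy : x ≤ y) :
    f 1 x - f 1 (x - 1) ≤ f 1 y - f 1 (y - 1) := by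
  rcases hxy.eq_or_lt with rfl | h
  · rfl
  · exact (increment_strictMono hx h).le

theorem h_one_eq_zero_of_size_eq_zero {G : SimpleGraph V} (hG : size G = 0) : h 1 G = 0 := by
  have h1 := sum_degree_eq G
  rw [hG, mul_zero, sum_eq_zero_iff] at h1
  exact sum_eq_zero fun v hv => by rw [h1 v hv, Nat.cast_zero, f_one_zero]

theorem h_one_eq_starValue {G : SimpleGraph V} {v : V} (hv : G.degree v = size G) :
    h 1 G = starValue (size G) := by
  have h1 := size_isolate G v
  have h0 : size (isolate G v) = 0 := by omega
  have h2 := sum_degree_eq (isolate G v)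
  rw [h0, mul_zero, sum_eq_zero_iff] at h2
  rw [h_one_eq_add_isolate G v, h_one_eq_zero_of_size_eq_zero h0, sum_congr rfl
    (g := fun _ => 2 * log 2)]
  · simp [starValue, hv, f]; ring
  · intro x hx
    rw [degree_isolate_of_adj (by simpa using hx), h2 x (mem_univ _)]
    norm_num [f]

end Deletion

end DegreeEntropy

namespace DegreeEntropy

/-! ### The maximum of `h 1` for a given number of edges. -/

section Maximum

open Classical Real Finset

theorem log_four : log 4 = 2 * log 2 := by
  rw [show (4 : ℝ) = 2 ^ 2 by norm_num, log_pow]; norm_num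

theorem log_eight : log 8 = 3 * log 2 := by
  rw [show (8 : ℝ) = 2 ^ 3 by norm_num, log_pow]; norm_num

theorem log_six : log 6 = log 2 + log 3 := by
  rw [show (6 : ℝ) = 2 * 3 by norm_num, log_mul] <;> norm_num

theorem log_nine : log 9 = 2 * log 3 := by
  rw [show (9 : ℝ) = 3 ^ 2 by norm_num, log_pow]; norm_num

theorem starValue_five : starValue 5 = 16 * log 2 + 6 * log 3 := by
  norm_num [starValue, log_six]; ring

variable {V : Type*} [Fintype V]

/-- A graph with `a` edges that has a vertex of degree `a`, or is one of the small exceptional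
maximizers of `h_1`, or has `h_1` less than the star. -/
def StarOrSmallOrLess (a : ℕ) (G : SimpleGraph V) : Prop :=
  (∃ v, G.degree v = a) ∨ (a = 3 ∧ #(positiveVerts G) = 3 ∧ h 1 G = 9 * log 3) ∨
    (a = 5 ∧ #(positiveVerts G) = 4 ∧ h 1 G = starValue 5) ∨
    (a = 6 ∧ #(positiveVerts G) = 4 ∧ h 1 G = 32 * log 2) ∨ h 1 G < starValue a

theorem StarOrSmallOrLess.bound {a : ℕ} {G : SimpleGraph V} (hG : size G = a)
    (h1 : StarOrSmallOrLess a G) : h 1 G ≤ starValue a ∨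
      (a = 3 ∧ h 1 G = 9 * log 3) ∨ (a = 6 ∧ #(positiveVerts G) = 4 ∧ h 1 G = 32 * log 2) := by
  rcases h1 with ⟨v, hv⟩ | h1 | h1 | h1 | h1
  · left; subst hG; exact (h_one_eq_starValue hv).le
  · exact Or.inr (Or.inl ⟨h1.1, h1.2.2⟩)
  · left; rw [h1.2.2, h1.1]; norm_num
  · exact Or.inr (Or.inr h1)
  · exact Or.inl h1.le

/-- Apart from the leaf's own term, the gain is the increment at its neighbour `u`. As `G` is not a
star, `deg u ≤ a`, below the degree `a + 1` that the centre of a star would reach. If the rest beats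
the star (`a = 3` or `a = 6`), numbers decide. -/
theorem h_one_lt_starValue_of_pendant {a : ℕ} {G : SimpleGraph V} (hG : size G = a + 1)
    (hstar : ¬ ∃ v, G.degree v = a + 1) {v : V} (hv : G.degree v = 1)
    (ih : StarOrSmallOrLess a (isolate G v)) : h 1 G < starValue (a + 1 : ℕ) := by
  have hsz := size_isolate G v
  obtain ⟨u, hu⟩ := card_eq_one.1 ((G.card_neighborFinset_eq_degree v).trans hv)
  have huv : G.Adj v u := by
    rw [← SimpleGraph.mem_neighborFinset, hu, mem_singleton]
  have e := h_one_eq_add_isolate G v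
  rw [hu, sum_singleton, hv] at e
  have f11 : f 1 (1 : ℕ) = 2 * log 2 := by norm_num [f]
  rw [f11] at e
  have hdu := degree_isolate_of_adj huv
  have hu0 : (0 : ℝ) < G.degree u := by rw [hdu]; positivity
  have hule : G.degree u ≤ a := by
    have h1 := size_isolate G u
    have h2 : G.degree u ≠ a + 1 := fun h => hstar ⟨u, h⟩
    omega
  have hule' : (G.degree u : ℝ) ≤ a := by exact_mod_cast hule
  rcases ih.bound (by omega) with h1 | ⟨rfl, h1⟩ | ⟨rfl, h2, h1⟩
  · have h3 := increment_strictMono hu0 (show (G.degree u : ℝ) < a + 1 by linarith)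
    have h4 : starValue (a + 1 : ℕ) = starValue a + 2 * log 2 +
        (f 1 (a + 1) - f 1 ((a : ℝ) + 1 - 1)) := by
      simp [starValue, f]; ring
    linarith
  · have h3 := increment_mono hu0 hule'
    rw [f_one_sub_f_one (3 : ℕ)] at h3
    norm_num [log_four] at h3
    have h4 := log_lt_log (by norm_num) (show (3 : ℝ) ^ 6 * 2 ^ 2 < 5 ^ 5 by norm_num)
    rw [log_mul (by norm_num) (by norm_num), log_pow, log_pow, log_pow] at h4
    norm_num [starValue] at h4 ⊢
    linarith
  · have h5 : G.degree u ≤ 4 := by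
      by_cases h0 : 0 < (isolate G v).degree u
      · have := degree_lt_card_positiveVerts (mem_positiveVerts.2 h0)
        omega
      · omega
    have h3 := increment_mono hu0 (show (G.degree u : ℝ) ≤ 4 by exact_mod_cast h5)
    rw [f_one_sub_f_one 4] at h3
    norm_num [log_four] at h3
    have h4 := log_lt_log (by norm_num) (show (5 : ℝ) ^ 5 < 2 ^ 12 by norm_num)
    rw [log_pow, log_pow] at h4
    norm_num [starValue, log_eight] at h4 ⊢
    linarith

theorem h_one_lt_starValue_of_minDegree {a d : ℕ} {G : SimpleGraph V} (hG : size G = a)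
    {v : V} (hv : G.degree v = d) (hd : 2 ≤ d) (hda : d * (d + 1) ≤ 2 * a)
    (h67 : 7 ≤ a ∨ d = 2 ∧ 6 ≤ a) (h104 : ¬ (a = 10 ∧ d = 4))
    (ih : StarOrSmallOrLess (a - d) (isolate G v)) : h 1 G < starValue a := by
  have hsz := size_isolate G v
  have hle : d ≤ a := by omega
  have e := h_one_eq_add_isolate G v
  have h1 := sum_increment_le G (v := v) (by omega)
  rw [hv, hG] at h1
  rw [hv] at e
  have h2 := gain_lt hd hda h67
  have hf : f 1 (d : ℝ) = (d + 1) * log (d + 1) := rfl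
  rcases ih.bound (by omega) with h3 | ⟨h3, -⟩ | ⟨h6, -, h3⟩
  · rw [Nat.cast_sub hle] at h3
    linarith
  -- A remainder of 3 edges forces `(a, d)` to be `(5, 2)` or `(6, 3)`, both excluded by `h67`.
  · exfalso
    have : d ≤ 3 := by
      by_contra hc
      nlinarith [show a = d + 3 by omega]
    interval_cases d <;> omega
  -- A remainder of 6 edges may exceed the star value. It leaves `(a, d) = (8, 2)` and `(9, 3)`,
  -- since `(10, 4)` is excluded.
  · have hd3 : d ≤ 4 := by
      by_contra hc
      nlinarith [show a = d + 6 by omega]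
    have l2 := log_two_gt_d9
    have : d = 2 ∨ d = 3 := by omega
    rcases this with rfl | rfl
    · obtain rfl : a = 8 := by omega
      have h4 := log_lt_log (by norm_num) (show (2 : ℝ) ^ 19 * 5 ^ 2 < 3 ^ 15 by norm_num)
      rw [log_mul (by norm_num) (by norm_num), log_pow, log_pow, log_pow] at h4
      rw [hf] at e
      norm_num [starValue, log_nine] at h1 h4 e ⊢
      linarith
    · obtain rfl : a = 9 := by omega
      have h4 := mul_log_two_lt_log (p := 9) (q := 2) (by norm_num)
        (show (2 : ℝ) ^ 9 < (10 ^ 10 / (2 ^ 22 * (9 / 2) ^ 3)) ^ 2 by norm_num)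
      rw [log_div (by norm_num) (by norm_num), log_mul (by norm_num) (by norm_num), log_pow,
        log_pow, log_pow] at h4
      rw [hf] at e
      norm_num [starValue, log_four] at h1 h4 e ⊢
      linarith

theorem starOrSmallOrLess [Nonempty V] (a : ℕ) :
    ∀ G : SimpleGraph V, size G = a → StarOrSmallOrLess a G := by
  induction a using Nat.strong_induction_on with
  | _ a ih =>
  intro G hG
  by_cases hstar : ∃ v, G.degree v = a
  · exact Or.inl hstar
  have hne : (positiveVerts G).Nonempty := by
    rw [nonempty_iff_ne_empty]
    intro h0
    have h1 := sum_positiveVerts_degree G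
    rw [h0, sum_empty] at h1
    obtain ⟨v⟩ := ‹Nonempty V›
    have hv : v ∉ positiveVerts G := by simp [h0]
    rw [mem_positiveVerts] at hv
    exact hstar ⟨v, by omega⟩
  obtain ⟨v, hv, hmin⟩ := exists_min_image _ (fun v => G.degree v) hne
  have hv0 := mem_positiveVerts.1 hv
  have hsz := size_isolate G v
  have ihv := ih (a - G.degree v) (by omega) (isolate G v) (by omega)
  have hs1 := degree_lt_card_positiveVerts hv
  have hs2 := mul_card_positiveVerts_le hmin
  have hs3 := two_mul_size_le G
  have hreg := h_one_eq_of_regular hmin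
  obtain ⟨d, hd⟩ : ∃ d, G.degree v = d := ⟨_, rfl⟩
  obtain ⟨s, hs⟩ : ∃ s, #(positiveVerts G) = s := ⟨_, rfl⟩
  rw [hG, hd, hs] at hreg
  rw [hd, hs] at hs1
  rw [hd, hs, hG] at hs2
  rw [hs, hG] at hs3
  have hda : d * (d + 1) ≤ 2 * a := by nlinarith
  rw [hd] at ihv hv0
  have hle : d ≤ a := by omega
  by_cases hd1 : d = 1
  · subst hd1
    obtain ⟨b, rfl⟩ : ∃ b, a = b + 1 := ⟨a - 1, by omega⟩
    exact Or.inr (Or.inr (Or.inr (Or.inr (h_one_lt_starValue_of_pendant hG hstar hd ihv))))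
  by_cases hgen : (7 ≤ a ∨ d = 2 ∧ 6 ≤ a) ∧ ¬ (a = 10 ∧ d = 4)
  · exact Or.inr (Or.inr (Or.inr (Or.inr
      (h_one_lt_starValue_of_minDegree hG hd (by omega) hda hgen.1 hgen.2 ihv))))
  -- This is `K_5`: deleting a vertex leaves `K_4`, which beats the star, so the value is computed
  -- directly.
  by_cases h10 : a = 10 ∧ d = 4
  · obtain ⟨rfl, rfl⟩ := h10
    obtain rfl : s = 5 := by omega
    right; right; right; right
    rw [hreg (by norm_num)]
    have h4 := log_lt_log (by norm_num) (show (5 : ℝ) ^ 25 < 11 ^ 11 * 2 ^ 20 by norm_num)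
    rw [log_mul (by norm_num) (by norm_num), log_pow, log_pow, log_pow] at h4
    norm_num [starValue, f] at h4 ⊢
    linarith
  have ha : a ≤ 6 := by omega
  have hd3 : d ≤ 3 := by nlinarith
  have hs6 : s ≤ 6 := by nlinarith [show 2 ≤ d by omega]
  have hs3' : 3 ≤ s := by omega
  have ha3 : 3 ≤ a := by nlinarith [show 2 ≤ d by omega]
  -- In these cases `d` and the degree sum fix all positive degrees, hence `h 1`.
  have cases : (a = 3 ∧ d = 2 ∧ s = 3) ∨ (a = 4 ∧ d = 2 ∧ s = 4) ∨ (a = 5 ∧ d = 2 ∧ s = 5) ∨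
      (a = 5 ∧ d = 2 ∧ s = 4) ∨ (a = 6 ∧ d = 3 ∧ s = 4) := by
    clear hreg ihv ih
    have : d = 2 ∨ d = 3 := by omega
    rcases this with rfl | rfl <;> interval_cases s <;> omega
  rcases cases with ⟨rfl, rfl, rfl⟩ | ⟨rfl, rfl, rfl⟩ | ⟨rfl, rfl, rfl⟩ | ⟨rfl, rfl, rfl⟩ |
    ⟨rfl, rfl, rfl⟩
  · refine Or.inr (Or.inl ⟨rfl, hs, ?_⟩)
    rw [hreg (by norm_num)]
    norm_num [f]; ring
  · right; right; right; right
    rw [hreg (by norm_num)]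
    have h4 := log_lt_log (by norm_num) (show (3 : ℝ) ^ 12 < 5 ^ 5 * 2 ^ 8 by norm_num)
    rw [log_mul (by norm_num) (by norm_num), log_pow, log_pow, log_pow] at h4
    norm_num [starValue, f] at h4 ⊢
    linarith
  · right; right; right; right
    rw [hreg (by norm_num)]
    have h4 := log_lt_log (by norm_num) (show (3 : ℝ) ^ 15 < 2 ^ 16 * 3 ^ 6 by norm_num)
    rw [log_mul (by norm_num) (by norm_num), log_pow, log_pow, log_pow] at h4
    norm_num [starValue_five, f] at h4 ⊢
    linarith
  · refine Or.inr (Or.inr (Or.inl ⟨rfl, hs, ?_⟩))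
    rw [h_one_eq_of_two_degrees (d := 2), hs, hG, starValue_five]
    · norm_num [f, log_four]; ring
    · intro x hx
      have h1 := hmin x hx
      have h2 := degree_lt_card_positiveVerts hx
      omega
  · refine Or.inr (Or.inr (Or.inr (Or.inl ⟨rfl, hs, ?_⟩)))
    rw [hreg (by norm_num)]
    norm_num [f, log_four]; ring

end Maximum

end DegreeEntropy

namespace DegreeEntropy

/-! ### Recognizing the maximizers up to isolated vertices. -/

section Patterns

open Classical Real Finset

theorem degree_eq_ncard {V : Type*} (G : SimpleGraph V) (v : V) [Fintype (G.neighborSet v)] :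
    G.degree v = (G.neighborSet v).ncard := by
  rw [← SimpleGraph.card_neighborSet_eq_degree, Set.ncard_eq_toFinset_card', Set.toFinset_card]

variable {V W : Type*} [Fintype V] [Fintype W]

theorem h_eq_sum_degreeSequence (c : ℝ) (G : SimpleGraph V) :
    h c G = ((degreeSequence G).map fun d : ℕ => f c d).sum := by
  rw [degreeSequence, Multiset.map_map]; rfl

theorem sum_degreeSequence (G : SimpleGraph V) : (degreeSequence G).sum = 2 * size G :=
  sum_degree_eq G

theorem degreeSequence_congr {G : SimpleGraph V} {H : SimpleGraph W} (e : G ≃g H) :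
    degreeSequence G = degreeSequence H := by
  have h1 : (univ : Finset W).val = (univ : Finset V).val.map e := by
    rw [← Finset.map_univ_equiv e.toEquiv]; rfl
  rw [degreeSequence, degreeSequence, h1, Multiset.map_map]
  refine Multiset.map_congr rfl fun v _ => ?_
  simp

theorem degreeSequence_sum_bot (P : SimpleGraph W) (k : ℕ) :
    degreeSequence (P.sum (⊥ : SimpleGraph (Fin k))) =
      degreeSequence P + Multiset.replicate k 0 := by
  have h1 : (univ : Finset (W ⊕ Fin k)).val =
    Multiset.disjSum (univ : Finset W).val (univ : Finset (Fin k)).val := rfl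
  rw [degreeSequence, degreeSequence, h1, Multiset.map_disjSum]
  congr 1
  · refine Multiset.map_congr rfl fun v _ => ?_
    rw [degree_eq_ncard, degree_eq_ncard, SimpleGraph.neighborSet_sum_inl,
      Set.ncard_image_of_injective _ Sum.inl_injective]
  · refine Multiset.eq_replicate.2 ⟨by simp, fun d hd => ?_⟩
    obtain ⟨w, -, rfl⟩ := Multiset.mem_map.1 hd
    rw [degree_eq_ncard, SimpleGraph.neighborSet_sum_inr]
    simp

theorem IsUpToIsolated.degreeSequence_eq {G : SimpleGraph V} {P : SimpleGraph W}
    (hG : IsUpToIsolated G P) : degreeSequence G =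
      degreeSequence P + Multiset.replicate (Fintype.card V - Fintype.card W) 0 := by
  obtain ⟨k, ⟨e⟩⟩ := hG
  have h1 := Fintype.card_congr e.toEquiv
  rw [Fintype.card_sum, Fintype.card_fin] at h1
  rw [degreeSequence_congr e, degreeSequence_sum_bot, h1, Nat.add_sub_cancel_left]

theorem IsUpToIsolated.size_eq {G : SimpleGraph V} {P : SimpleGraph W}
    (hG : IsUpToIsolated G P) : size G = size P := by
  have h1 := sum_degreeSequence G
  rw [hG.degreeSequence_eq, Multiset.sum_add, sum_degreeSequence, Multiset.sum_replicate] at h1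
  simp at h1
  omega

theorem IsUpToIsolated.h_one_eq {G : SimpleGraph V} {P : SimpleGraph W}
    (hG : IsUpToIsolated G P) : h 1 G = h 1 P := by
  rw [h_eq_sum_degreeSequence, hG.degreeSequence_eq, Multiset.map_add, Multiset.sum_add,
    ← h_eq_sum_degreeSequence, Multiset.map_replicate, Multiset.sum_replicate]
  simp [f_one_zero]

theorem isUpToIsolated_map (P : SimpleGraph W) (g : W ↪ V) : IsUpToIsolated (P.map g) P := by
  let e : W ⊕ Fin (Fintype.card ((Set.range g)ᶜ : Set V)) ≃ V :=
    (Equiv.sumCongr (Equiv.ofInjective g g.injective) (Fintype.equivFin _).symm).trans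
      (Equiv.Set.sumCompl (Set.range g))
  have e1 : ∀ w, e (Sum.inl w) = g w := fun w => rfl
  have e2 : ∀ i w, g w ≠ e (Sum.inr i) := by
    intro i w h1
    rw [← e1] at h1
    exact Sum.inl_ne_inr (e.injective h1)
  refine ⟨_, ⟨SimpleGraph.Iso.symm ⟨e, ?_⟩⟩⟩
  rintro (x | x) (y | y)
  · simp [e1]
  · simp only [e1, SimpleGraph.map_adj, SimpleGraph.not_adj_sum_inl_inr, iff_false]
    rintro ⟨u, w, -, -, h2⟩
    exact e2 _ _ h2
  · rw [SimpleGraph.adj_comm, SimpleGraph.adj_comm (P.sum _)]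
    simp only [e1, SimpleGraph.map_adj, SimpleGraph.not_adj_sum_inl_inr, iff_false]
    rintro ⟨u, w, -, -, h2⟩
    exact e2 _ _ h2
  · simp only [SimpleGraph.map_adj, SimpleGraph.sum_adj_inr, SimpleGraph.bot_adj, iff_false]
    rintro ⟨u, w, -, -, h2⟩
    exact e2 _ _ h2

theorem exists_isUpToIsolated (P : SimpleGraph W) (hc : Fintype.card W ≤ Fintype.card V) :
    ∃ G : SimpleGraph V, IsUpToIsolated G P := by
  obtain ⟨g⟩ := Function.Embedding.nonempty_of_card_le hc
  exact ⟨_, isUpToIsolated_map P g⟩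

theorem eq_of_le_of_size_le {G H : SimpleGraph V} (hle : G ≤ H) (hs : size H ≤ size G) :
    G = H :=
  SimpleGraph.edgeSet_inj.1
    (Set.eq_of_subset_of_ncard_le (SimpleGraph.edgeSet_subset_edgeSet.2 hle) hs)

theorem size_map (P : SimpleGraph W) (g : W ↪ V) : size (P.map g) = size P :=
  (isUpToIsolated_map P g).size_eq

theorem degreeSequence_star (a : ℕ) :
    degreeSequence (star a) = {a} + Multiset.replicate a 1 := by
  have h1 : (univ : Finset (Fin 1 ⊕ Fin a)).val =
    Multiset.disjSum (univ : Finset (Fin 1)).val (univ : Finset (Fin a)).val := rfl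
  rw [degreeSequence, h1, Multiset.map_disjSum]
  have h2 : ∀ i ∈ (univ : Finset (Fin 1)).val, (star a).degree (Sum.inl i) = a := by
    intro i _
    have : (star a).neighborSet (Sum.inl i) = Sum.inr '' Set.univ := by
      ext x; cases x <;> simp [star, completeBipartiteGraph]
    rw [degree_eq_ncard, this, Set.ncard_image_of_injective _ Sum.inr_injective, Set.ncard_univ]
    simp
  have h3 : ∀ i ∈ (univ : Finset (Fin a)).val, (star a).degree (Sum.inr i) = 1 := by
    intro i _
    have : (star a).neighborSet (Sum.inr i) = Sum.inl '' Set.univ := by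
      ext x; cases x <;> simp [star, completeBipartiteGraph]
    rw [degree_eq_ncard, this, Set.ncard_image_of_injective _ Sum.inl_injective, Set.ncard_univ]
    simp
  rw [Multiset.map_congr rfl h2, Multiset.map_congr rfl h3, Multiset.map_const',
    Multiset.map_const']
  simp

theorem degreeSequence_top (k : ℕ) :
    degreeSequence (⊤ : SimpleGraph (Fin k)) = Multiset.replicate k (k - 1) := by
  refine Multiset.eq_replicate.2 ⟨by simp [degreeSequence], fun d hd => ?_⟩
  obtain ⟨i, -, rfl⟩ := Multiset.mem_map.1 hd
  have := SimpleGraph.complete_graph_degree (V := Fin k) i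
  rw [degree_eq_ncard, Fintype.card_fin] at this
  rw [degree_eq_ncard, this]

theorem degreeSequence_K4minus :
    degreeSequence K4minus = Multiset.replicate 2 3 + Multiset.replicate 2 2 := by
  have h1 : ∀ i ∈ (univ : Finset (Fin 4)).val, K4minus.degree i = ![3, 3, 2, 2] i := by
    intro i _
    have : ∀ i : Fin 4, ((⊤ : SimpleGraph (Fin 4)).deleteEdges {s(2, 3)}).degree i =
        ![3, 3, 2, 2] i := by decide
    rw [← this i, degree_eq_ncard, degree_eq_ncard]
    rfl
  rw [degreeSequence, Multiset.map_congr rfl h1]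
  decide

theorem size_star (a : ℕ) : size (star a) = a := by
  have h1 := sum_degreeSequence (star a)
  simp [degreeSequence_star] at h1
  omega

theorem size_top_three : size (⊤ : SimpleGraph (Fin 3)) = 3 := by
  have h1 := sum_degreeSequence (⊤ : SimpleGraph (Fin 3))
  simp [degreeSequence_top] at h1
  omega

theorem size_top_four : size (⊤ : SimpleGraph (Fin 4)) = 6 := by
  have h1 := sum_degreeSequence (⊤ : SimpleGraph (Fin 4))
  simp [degreeSequence_top] at h1
  omega

theorem size_K4minus : size K4minus = 5 := by
  have h1 := sum_degreeSequence K4minus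
  simp [degreeSequence_K4minus] at h1
  omega

theorem h_one_star (a : ℕ) : h 1 (star a) = starValue a := by
  rw [h_eq_sum_degreeSequence, degreeSequence_star]
  norm_num [f, starValue]; ring

theorem h_one_top_three : h 1 (⊤ : SimpleGraph (Fin 3)) = 9 * log 3 := by
  rw [h_eq_sum_degreeSequence, degreeSequence_top]
  norm_num [f]; ring

theorem h_one_top_four : h 1 (⊤ : SimpleGraph (Fin 4)) = 32 * log 2 := by
  rw [h_eq_sum_degreeSequence, degreeSequence_top]
  norm_num [f, log_four]; ring

theorem h_one_K4minus : h 1 K4minus = starValue 5 := by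
  rw [h_eq_sum_degreeSequence, degreeSequence_K4minus, starValue_five]
  norm_num [f, log_four]; ring

/-- The star at `v` is a subgraph with as many edges as `G`, so it is all of `G`. -/
theorem isUpToIsolated_star {G : SimpleGraph V} {v : V} (hv : G.degree v = size G) :
    IsUpToIsolated G (star (size G)) := by
  have hc : Fintype.card (G.neighborSet v) = size G := by
    rw [SimpleGraph.card_neighborSet_eq_degree, hv]
  let e : Fin (size G) ≃ G.neighborSet v := (Fintype.equivFinOfCardEq hc).symm
  let g : Fin 1 ⊕ Fin (size G) ↪ V :=
    ⟨Sum.elim (fun _ => v) fun i => e i, by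
      rintro (i | i) (j | j) hij
      · rw [Subsingleton.elim i j]
      · exact absurd hij (G.ne_of_adj (e j).2)
      · exact absurd hij.symm (G.ne_of_adj (e i).2)
      · exact congrArg Sum.inr (e.injective (Subtype.ext hij))⟩
  have hle : (star (size G)).map g ≤ G := by
    rw [SimpleGraph.map_le_iff_le_comap]
    rintro (i | i) (j | j) hij
    · simp [star] at hij
    · exact (e j).2
    · exact (e i).2.symm
    · simp [star] at hij
  have := eq_of_le_of_size_le hle (by rw [size_map, size_star])
  rw [← this, size_map, size_star]
  exact isUpToIsolated_map _ _

theorem exists_le_map_top {G : SimpleGraph V} {k : ℕ} (hk : #(positiveVerts G) = k) :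
    ∃ g : Fin k ↪ V, G ≤ (⊤ : SimpleGraph (Fin k)).map g := by
  let e : Fin k ≃ positiveVerts G := (Fintype.equivFinOfCardEq (by simp [hk])).symm
  refine ⟨e.toEmbedding.trans (Function.Embedding.subtype _), fun x y hxy => ?_⟩
  have hx : x ∈ positiveVerts G :=
    mem_positiveVerts.2 ((G.degree_pos_iff_exists_adj x).2 ⟨y, hxy⟩)
  have hy : y ∈ positiveVerts G :=
    mem_positiveVerts.2 ((G.degree_pos_iff_exists_adj y).2 ⟨x, hxy.symm⟩)
  rw [SimpleGraph.map_adj]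
  refine ⟨e.symm ⟨x, hx⟩, e.symm ⟨y, hy⟩, ?_, by simp, by simp⟩
  simpa using hxy.ne

theorem isUpToIsolated_top {G : SimpleGraph V} {k : ℕ} (hk : #(positiveVerts G) = k)
    (hs : size G = size (⊤ : SimpleGraph (Fin k))) :
    IsUpToIsolated G (⊤ : SimpleGraph (Fin k)) := by
  obtain ⟨g, hg⟩ := exists_le_map_top hk
  rw [eq_of_le_of_size_le hg (by rw [size_map, hs])]
  exact isUpToIsolated_map _ _

theorem isUpToIsolated_K4minus {G : SimpleGraph V} (hk : #(positiveVerts G) = 4)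
    (hs : size G = 5) : IsUpToIsolated G K4minus := by
  obtain ⟨g, hg⟩ := exists_le_map_top hk
  obtain ⟨i, j, hij, hG⟩ : ∃ i j : Fin 4, i ≠ j ∧ ¬ G.Adj (g i) (g j) := by
    by_contra! hc
    have : (⊤ : SimpleGraph (Fin 4)).map g ≤ G := by
      rw [SimpleGraph.map_le_iff_le_comap]
      exact fun i j hij => hc i j hij
    have h1 := size_map (⊤ : SimpleGraph (Fin 4)) g
    rw [← le_antisymm hg this, hs, size_top_four] at h1
    omega
  -- Relabels so that the missing pair becomes the edge removed in `K4minus`.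
  obtain ⟨σ, rfl, rfl⟩ : ∃ σ : Equiv.Perm (Fin 4), σ 2 = i ∧ σ 3 = j := by
    clear hG
    revert i j; decide
  have hle : G ≤ K4minus.map (σ.toEmbedding.trans g) := by
    intro x y hxy
    obtain ⟨i, j, hij', rfl, rfl⟩ := (SimpleGraph.map_adj _ _ _ _).1 (hg hxy)
    rw [SimpleGraph.map_adj]
    refine ⟨σ.symm i, σ.symm j, ?_, by simp, by simp⟩
    rw [K4minus, SimpleGraph.deleteEdges_adj]
    refine ⟨by simpa using hij', fun h1 => ?_⟩
    rw [Set.mem_singleton_iff, Sym2.eq_iff, Equiv.symm_apply_eq, Equiv.symm_apply_eq,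
      Equiv.symm_apply_eq, Equiv.symm_apply_eq] at h1
    rcases h1 with ⟨rfl, rfl⟩ | ⟨rfl, rfl⟩
    · exact hG hxy
    · exact hG hxy.symm
  rw [eq_of_le_of_size_le hle (by rw [size_map, hs, size_K4minus])]
  exact isUpToIsolated_map _ _

/-- The maximum of `h_1` over the graphs with `a` edges. -/
noncomputable def h1Max (a : ℕ) : ℝ :=
  if a = 3 then 9 * log 3 else if a = 6 then 32 * log 2 else starValue a

theorem starValue_three_lt : starValue 3 < 9 * log 3 := by
  have h4 := log_lt_log (by norm_num) (show (2 : ℝ) ^ 14 < 3 ^ 9 by norm_num)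
  rw [log_pow, log_pow] at h4
  norm_num [starValue, log_four] at h4 ⊢
  linarith

theorem starValue_six_lt : starValue 6 < 32 * log 2 := by
  have h4 := log_lt_log (by norm_num) (show (7 : ℝ) ^ 7 < 2 ^ 20 by norm_num)
  rw [log_pow, log_pow] at h4
  norm_num [starValue] at h4 ⊢
  linarith

theorem starValue_le_h1Max (a : ℕ) : starValue a ≤ h1Max a := by
  unfold h1Max
  split_ifs with h3 h6
  · subst h3; exact_mod_cast starValue_three_lt.le
  · subst h6; exact_mod_cast starValue_six_lt.le
  · rfl

theorem h_one_le_h1Max (G : SimpleGraph V) : h 1 G ≤ h1Max (size G) := by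
  rcases isEmpty_or_nonempty V with hV | hV
  · have h0 : size G = 0 := by
      have := sum_degree_eq G
      simp at this; omega
    rw [h_one_eq_zero_of_size_eq_zero h0, h0]
    simp [h1Max, starValue]
  · have h1 := starValue_le_h1Max (size G)
    rcases (starOrSmallOrLess _ G rfl).bound rfl with h2 | ⟨h2, h3⟩ | ⟨h2, -, h3⟩
    · exact h2.trans h1
    · rw [h3, h2]; simp [h1Max]
    · rw [h3, h2]; simp [h1Max]

theorem isH1ExtremalForm_of_h_one_eq [Nonempty V] {a : ℕ} {G : SimpleGraph V}
    (hs : size G = a) (hG : h 1 G = h1Max a) : IsH1ExtremalForm a G := by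
  have h1 := starValue_le_h1Max a
  unfold IsH1ExtremalForm
  rcases starOrSmallOrLess a G hs with ⟨v, hv⟩ | ⟨rfl, h2, -⟩ | ⟨rfl, h2, -⟩ | ⟨rfl, h2, -⟩ | h2
  · have h3 := h_one_eq_starValue (hv.trans hs.symm)
    have h4 := isUpToIsolated_star (hv.trans hs.symm)
    rw [hs] at h3 h4
    split_ifs with e3 e5 e6
    · subst e3
      have := starValue_three_lt
      rw [hG] at h3
      norm_num [h1Max] at h3
      linarith
    · subst e5; exact Or.inr h4
    · subst e6
      have := starValue_six_lt
      rw [hG] at h3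
      norm_num [h1Max] at h3
      linarith
    · exact h4
  · simpa using isUpToIsolated_top h2 (hs.trans size_top_three.symm)
  · simpa using Or.inl (isUpToIsolated_K4minus h2 hs)
  · simpa using isUpToIsolated_top h2 (hs.trans size_top_four.symm)
  · linarith

theorem IsH1ExtremalForm.size_eq_and_h_one_eq {a : ℕ} {G : SimpleGraph V}
    (hG : IsH1ExtremalForm a G) : size G = a ∧ h 1 G = h1Max a := by
  unfold IsH1ExtremalForm at hG
  split_ifs at hG with e3 e5 e6
  · subst e3
    exact ⟨hG.size_eq.trans size_top_three, by simp [hG.h_one_eq, h_one_top_three, h1Max]⟩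
  · subst e5
    rcases hG with hG | hG
    · exact ⟨hG.size_eq.trans size_K4minus, by simp [hG.h_one_eq, h_one_K4minus, h1Max]⟩
    · exact ⟨hG.size_eq.trans (size_star 5), by simp [hG.h_one_eq, h_one_star, h1Max]⟩
  · subst e6
    exact ⟨hG.size_eq.trans size_top_four, by simp [hG.h_one_eq, h_one_top_four, h1Max]⟩
  · exact ⟨hG.size_eq.trans (size_star a), by simp [hG.h_one_eq, h_one_star, h1Max, e3, e6]⟩

theorem exists_isH1ExtremalForm {a : ℕ} (ha : a + 1 ≤ Fintype.card V) :
    ∃ G : SimpleGraph V, IsH1ExtremalForm a G := by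
  unfold IsH1ExtremalForm
  split_ifs with e3 e5 e6
  · exact exists_isUpToIsolated _ (by simp; omega)
  · obtain ⟨G, hG⟩ := exists_isUpToIsolated (V := V) K4minus (by simp; omega)
    exact ⟨G, Or.inl hG⟩
  · exact exists_isUpToIsolated _ (by simp; omega)
  · exact exists_isUpToIsolated _ (by simp; omega)

theorem isH1Maximizer_iff {a : ℕ} {G : SimpleGraph V} :
    IsH1Maximizer a G ↔ size G = a ∧ h 1 G = h1Max a := by
  refine and_congr_right fun hs => ⟨fun hG => ?_, fun hG k H hH => ?_⟩
  · obtain ⟨H, hH⟩ := exists_isH1ExtremalForm (V := Fin (a + 1)) (a := a) (by simp)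
    obtain ⟨h1, h2⟩ := hH.size_eq_and_h_one_eq
    have h3 := hG _ H h1
    have h4 := h_one_le_h1Max G
    rw [hs] at h4
    linarith
  · rw [hG, ← hH]; exact h_one_le_h1Max H

theorem isH1ExtremalForm_iff [Nonempty V] {a : ℕ} {G : SimpleGraph V} :
    IsH1ExtremalForm a G ↔ size G = a ∧ h 1 G = h1Max a :=
  ⟨fun hG => hG.size_eq_and_h_one_eq, fun hG => isH1ExtremalForm_of_h_one_eq hG.1 hG.2⟩

end Patterns

end DegreeEntropy

namespace DegreeEntropy

/-! ### From minimum entropy to maximum `h 1`: edge shifts, universal vertices and cones. -/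

section Entropy

open Classical Real Finset

variable {V : Type*} [Fintype V]

theorem entropy_eq {G : SimpleGraph V} (hG : 0 < size G) :
    entropy G = log (2 * size G) - h 0 G / (2 * size G) := by
  have hm : (0 : ℝ) < 2 * size G := by positivity
  have h1 : ∀ v, (G.degree v : ℝ) / (2 * size G) * log ((G.degree v : ℝ) / (2 * size G)) =
      f 0 (G.degree v) / (2 * size G) - G.degree v * (log (2 * size G) / (2 * size G)) := by
    intro v
    rcases Nat.eq_zero_or_pos (G.degree v) with h0 | h0
    · simp [h0, f]
    · have : (0 : ℝ) < G.degree v := by exact_mod_cast h0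
      rw [log_div this.ne' hm.ne', f, add_zero]
      ring
  have h2 : (∑ v, (G.degree v : ℝ)) = 2 * size G := by exact_mod_cast sum_degree_eq G
  unfold entropy
  rw [sum_congr rfl fun v _ => h1 v, sum_sub_distrib, ← sum_div, ← sum_mul, h2,
    mul_div_cancel₀ _ hm.ne']
  unfold h
  ring

theorem isEntropyMinimizer_iff {m : ℕ} (hm : 0 < m) {G : SimpleGraph V} :
    IsEntropyMinimizer m G ↔ G.Connected ∧ size G = m ∧
      ∀ H : SimpleGraph V, H.Connected → size H = m → h 0 H ≤ h 0 G := by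
  refine and_congr_right fun _ => and_congr_right fun hG => ?_
  refine forall_congr' fun H => forall_congr' fun _ => forall_congr' fun hH => ?_
  have hm' : (0 : ℝ) < 2 * m := by positivity
  rw [entropy_eq (by omega), entropy_eq (by omega), hG, hH, sub_le_sub_iff_left,
    div_le_div_iff_of_pos_right hm']

/-- The graph obtained from `G` by replacing the edge `uw` by `vw`. -/
def moveEdge (G : SimpleGraph V) (u v w : V) : SimpleGraph V :=
  SimpleGraph.fromEdgeSet (insert s(v, w) (G.edgeSet \ {s(u, w)}))

theorem moveEdge_adj {V : Type*} {G : SimpleGraph V} {u v w x y : V} : (moveEdge G u v w).Adj x y ↔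
    (s(x, y) = s(v, w) ∨ G.Adj x y ∧ s(x, y) ≠ s(u, w)) ∧ x ≠ y := by
  simp [moveEdge]

theorem degree_moveEdge_left {G : SimpleGraph V} {u v w : V} (hvu : G.Adj v u) (hvw : v ≠ w)
    (hnot : ¬ G.Adj v w) : (moveEdge G u v w).degree v = G.degree v + 1 := by
  have : (moveEdge G u v w).neighborSet v = insert w (G.neighborSet v) := by
    ext x
    simp only [SimpleGraph.mem_neighborSet, moveEdge_adj, Sym2.eq_iff, Set.mem_insert_iff]
    have := hvu.ne
    have := G.ne_of_adj (a := v) (b := x)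
    grind
  rw [degree_eq_ncard, degree_eq_ncard, this, Set.ncard_insert_of_notMem]
  exact hnot

theorem degree_moveEdge_middle {G : SimpleGraph V} {u v w : V} (hvu : G.Adj v u)
    (huw : G.Adj u w) : (moveEdge G u v w).degree u + 1 = G.degree u := by
  have : (moveEdge G u v w).neighborSet u = G.neighborSet u \ {w} := by
    ext x
    simp only [SimpleGraph.mem_neighborSet, moveEdge_adj, Sym2.eq_iff, Set.mem_sdiff,
      Set.mem_singleton_iff]
    have := hvu.ne
    have := huw.ne
    have := G.ne_of_adj (a := u) (b := x)
    grind
  rw [degree_eq_ncard, degree_eq_ncard, this]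
  exact Set.ncard_sdiff_singleton_add_one huw

theorem degree_moveEdge_of_ne {G : SimpleGraph V} {u v w x : V} (huw : G.Adj u w)
    (hnot : ¬ G.Adj v w) (hxv : x ≠ v) (hxu : x ≠ u) :
    (moveEdge G u v w).degree x = G.degree x := by
  rw [degree_eq_ncard, degree_eq_ncard]
  by_cases hxw : x = w
  · subst hxw
    have : (moveEdge G u v x).neighborSet x = insert v (G.neighborSet x \ {u}) := by
      ext y
      simp only [SimpleGraph.mem_neighborSet, moveEdge_adj, Sym2.eq_iff, Set.mem_sdiff,
        Set.mem_singleton_iff, Set.mem_insert_iff]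
      have := G.ne_of_adj (a := x) (b := y)
      grind
    rw [this, Set.ncard_insert_of_notMem fun h1 => hnot h1.1.symm]
    exact Set.ncard_sdiff_singleton_add_one huw.symm
  · have : (moveEdge G u v w).neighborSet x = G.neighborSet x := by
      ext y
      simp only [SimpleGraph.mem_neighborSet, moveEdge_adj, Sym2.eq_iff]
      have := G.ne_of_adj (a := x) (b := y)
      grind
    rw [this]

theorem sum_degree_moveEdge {G : SimpleGraph V} {u v w : V} (hvu : G.Adj v u) (huw : G.Adj u w)
    (hvw : v ≠ w) (hnot : ¬ G.Adj v w) (F : ℕ → ℝ) :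
    ∑ x, F ((moveEdge G u v w).degree x) =
    ∑ x, F (G.degree x) + (F (G.degree v + 1) - F (G.degree v)) +
      (F (G.degree u - 1) - F (G.degree u)) := by
  have key : ∀ x, F ((moveEdge G u v w).degree x) = F (G.degree x) +
      (if x = v then F (G.degree v + 1) - F (G.degree v) else 0) +
      (if x = u then F (G.degree u - 1) - F (G.degree u) else 0) := by
    intro x
    by_cases hxv : x = v
    · subst hxv
      simp [hvu.ne, degree_moveEdge_left hvu hvw hnot]
    · by_cases hxu : x = u
      · subst hxu
        simp [hxv, ← degree_moveEdge_middle hvu huw]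
      · simp [hxv, hxu, degree_moveEdge_of_ne huw hnot hxv hxu]
  rw [sum_congr rfl fun x _ => key x, sum_add_distrib, sum_add_distrib]
  simp

theorem size_moveEdge {G : SimpleGraph V} {u v w : V} (hvu : G.Adj v u) (huw : G.Adj u w)
    (hvw : v ≠ w) (hnot : ¬ G.Adj v w) :
    size (moveEdge G u v w) = size G := by
  have h1 := sum_degree_moveEdge hvu huw hvw hnot fun d => (d : ℝ)
  have hu : 1 ≤ G.degree u := by
    have := degree_moveEdge_middle hvu huw
    omega
  rw [← Nat.cast_sum, ← Nat.cast_sum, sum_degree_eq, sum_degree_eq, Nat.cast_sub hu] at h1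
  push_cast at h1
  have : (size (moveEdge G u v w) : ℝ) = size G := by linarith
  exact_mod_cast this

/-- Only the degrees of `v` (up by one) and `u` (down by one) change, and `deg u ≤ deg v`, so strict
convexity applies. -/
theorem h_zero_lt_h_zero_moveEdge {G : SimpleGraph V} {u v w : V} (hvu : G.Adj v u) (huw : G.Adj u w)
    (hvw : v ≠ w) (hnot : ¬ G.Adj v w)
    (hdeg : G.degree u ≤ G.degree v) :
    h 0 G < h 0 (moveEdge G u v w) := by
  have h1 := sum_degree_moveEdge hvu huw hvw hnot fun d => f 0 d
  have hu : 2 ≤ G.degree u := by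
    have h2 := degree_moveEdge_middle hvu huw
    have : 0 < (moveEdge G u v w).degree u := by
      rw [SimpleGraph.degree_pos_iff_exists_adj]
      refine ⟨v, moveEdge_adj.2 ⟨Or.inr ⟨hvu.symm, ?_⟩, hvu.ne'⟩⟩
      simp [hvw, huw.ne]
    omega
  have hu' : (2 : ℝ) ≤ G.degree u := by exact_mod_cast hu
  have hdeg' : (G.degree u : ℝ) ≤ G.degree v := by exact_mod_cast hdeg
  have h2 := increment_strictMono (x := (G.degree u : ℝ) - 1) (y := G.degree v) (by linarith)
    (by linarith)
  rw [Nat.cast_sub (by omega)] at h1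
  have h3 : ∀ x, f 1 x = f 0 (x + 1) := fun x => by simp [f]
  simp only [h3, sub_add_cancel] at h2
  push_cast at h1
  unfold h
  linarith

theorem connected_moveEdge {V : Type*} {G : SimpleGraph V} {u v w : V} (hvu : G.Adj v u)
    (huw : G.Adj u w) (hvw : v ≠ w) (hG : G.Connected) : (moveEdge G u v w).Connected := by
  have h1 : ∀ x y, G.Adj x y → (moveEdge G u v w).Reachable x y := by
    intro x y hxy
    have huw' : (moveEdge G u v w).Reachable u w := by
      have a1 : (moveEdge G u v w).Adj u v :=
        moveEdge_adj.2 ⟨Or.inr ⟨hvu.symm, by simp [hvw, huw.ne]⟩, hvu.ne'⟩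
      have a2 : (moveEdge G u v w).Adj v w := moveEdge_adj.2 ⟨Or.inl rfl, hvw⟩
      exact a1.reachable.trans a2.reachable
    by_cases hs : s(x, y) = s(u, w)
    · rcases Sym2.eq_iff.1 hs with ⟨rfl, rfl⟩ | ⟨rfl, rfl⟩
      · exact huw'
      · exact huw'.symm
    · exact (moveEdge_adj.2 ⟨Or.inr ⟨hxy, hs⟩, hxy.ne⟩ : (moveEdge G u v w).Adj x y).reachable
  have := hG.nonempty
  refine ⟨fun x y => ?_⟩
  obtain ⟨p⟩ := hG.preconnected x y
  induction p with
  | nil => rfl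
  | cons hadj _ ih => exact (h1 _ _ hadj).trans ih

theorem exists_isUniversal_of_isEntropyMinimizer {m : ℕ} (hm : 0 < m) {G : SimpleGraph V}
    (hG : IsEntropyMinimizer m G) : ∃ v, G.IsUniversal v := by
  obtain ⟨hconn, hsize, hmax⟩ := (isEntropyMinimizer_iff hm).1 hG
  have := hconn.nonempty
  obtain ⟨v, -, hv⟩ := exists_max_image univ (fun v => G.degree v) univ_nonempty
  refine ⟨v, ?_⟩
  -- Otherwise shifting `uw` to `vw` would contradict extremality; a walk from `v` therefore never
  -- leaves its closed neighbourhood.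
  have key : ∀ u w, G.Adj v u → G.Adj u w → v ≠ w → G.Adj v w := by
    intro u w hvu huw hvw
    by_contra hnot
    exact absurd (h_zero_lt_h_zero_moveEdge hvu huw hvw hnot (hv u (mem_univ u))) (not_lt.2
      (hmax _ (connected_moveEdge hvu huw hvw hconn)
        ((size_moveEdge hvu huw hvw hnot).trans hsize)))
  have walk : ∀ x y, G.Walk x y → (v = x ∨ G.Adj v x) → (v = y ∨ G.Adj v y) := by
    intro x y p
    induction p with
    | nil => exact id
    | cons hadj _ ih =>
      intro h1
      apply ih
      rcases h1 with rfl | h1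
      · exact Or.inr hadj
      · exact or_iff_not_imp_left.2 fun h2 => key _ _ h1 hadj h2
  intro x hx
  obtain ⟨p⟩ := hconn.preconnected v x
  exact (walk v x p (Or.inl rfl)).resolve_left hx

theorem isUniversal_of_degree {G : SimpleGraph V} {v : V}
    (hv : G.degree v = Fintype.card V - 1) : G.IsUniversal v := by
  rw [← SimpleGraph.neighborSet_eq_compl_singleton]
  refine Set.eq_of_subset_of_ncard_le (fun x hx => (G.ne_of_adj hx).symm) ?_
  rw [← degree_eq_ncard, hv, Set.ncard_compl, Set.ncard_singleton, Nat.card_eq_fintype_card]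

theorem degreeSequence_eq_of_isUniversal {G : SimpleGraph V} {v : V} (hv : G.IsUniversal v) :
    degreeSequence G = {Fintype.card V - 1} +
      (degreeSequence (G.induce ({v}ᶜ : Set V))).map (· + 1) := by
  have h1 : (univ : Finset V).val =
      {v} + (univ : Finset ({v}ᶜ : Set V)).val.map Subtype.val := by
    have : (univ : Finset V) = cons v ((univ : Finset ({v}ᶜ : Set V)).map
        (Function.Embedding.subtype _)) (by simp) := by
      ext x; simp [Classical.em]
    rw [this, cons_val, map_val]; rfl
  unfold degreeSequence
  rw [h1, Multiset.map_add, Multiset.map_singleton, Multiset.map_map, Multiset.map_map]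
  congr 1
  · rw [degree_eq_ncard, hv.neighborSet_eq, Set.ncard_compl, Set.ncard_singleton,
      Nat.card_eq_fintype_card]
  · refine Multiset.map_congr rfl fun x _ => ?_
    have : G.neighborSet x = insert v (Subtype.val '' (G.induce ({v}ᶜ : Set V)).neighborSet x) := by
      ext y
      have hx : v ≠ x := fun h => x.2 h.symm
      by_cases hy : y = v
      · subst hy
        simpa using (hv hx).symm
      · simp [hy]
    rw [Function.comp_apply, Function.comp_apply, degree_eq_ncard, degree_eq_ncard, this,
      Set.ncard_insert_of_notMem (by simp), Set.ncard_image_of_injective _ Subtype.val_injective]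

theorem card_degreeSequence (G : SimpleGraph V) :
    (degreeSequence G).card = Fintype.card V := by
  simp [degreeSequence]

theorem card_compl_singleton_set (v : V) :
    Fintype.card ({v}ᶜ : Set V) = Fintype.card V - 1 := by
  rw [Fintype.card_compl_set]; simp

theorem size_eq_of_isUniversal {G : SimpleGraph V} {v : V} (hv : G.IsUniversal v) :
    size G = size (G.induce ({v}ᶜ : Set V)) + (Fintype.card V - 1) := by
  have h1 := sum_degreeSequence G
  rw [degreeSequence_eq_of_isUniversal hv, Multiset.sum_add, Multiset.sum_map_add,
    Multiset.map_id', sum_degreeSequence, Multiset.map_const', Multiset.sum_replicate,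
    card_degreeSequence, card_compl_singleton_set, Multiset.sum_singleton] at h1
  simp at h1
  omega

theorem h_zero_eq_of_isUniversal {G : SimpleGraph V} {v : V} (hv : G.IsUniversal v) :
    h 0 G = f 0 (Fintype.card V - 1 : ℕ) + h 1 (G.induce ({v}ᶜ : Set V)) := by
  rw [h_eq_sum_degreeSequence, degreeSequence_eq_of_isUniversal hv, h_eq_sum_degreeSequence,
    Multiset.map_add, Multiset.map_map, Multiset.sum_add]
  simp [f]

/-- The graph obtained from a graph on the vertices other than `v` by making `v` universal. -/
def cone {V : Type*} (v : V) (H : SimpleGraph ({v}ᶜ : Set V)) : SimpleGraph V where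
  Adj x y := (x ≠ y ∧ (x = v ∨ y = v)) ∨ (H.map (Function.Embedding.subtype _)).Adj x y
  symm := ⟨fun _ _ hxy => hxy.imp (fun h => ⟨h.1.symm, h.2.symm⟩) SimpleGraph.Adj.symm⟩
  loopless := ⟨fun _ hx => hx.elim (fun h => h.1 rfl) fun h => h.ne rfl⟩

theorem cone_isUniversal {V : Type*} (v : V) (H : SimpleGraph ({v}ᶜ : Set V)) :
    (cone v H).IsUniversal v := fun _ hw => Or.inl ⟨hw, Or.inl rfl⟩

theorem induce_cone {V : Type*} (v : V) (H : SimpleGraph ({v}ᶜ : Set V)) :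
    (cone v H).induce ({v}ᶜ : Set V) = H := by
  ext x y
  have hx : (x : V) ≠ v := x.2
  have hy : (y : V) ≠ v := y.2
  have h1 : (H.map (Function.Embedding.subtype _)).Adj (x : V) y ↔ H.Adj x y :=
    SimpleGraph.map_adj_apply (f := Function.Embedding.subtype _)
  rw [← h1]
  simp [cone, hx, hy]

theorem exists_max_h_zero {m : ℕ} {G : SimpleGraph V} (hm : 0 < m) (hG : G.Connected)
    (hs : size G = m) : ∃ H : SimpleGraph V, IsEntropyMinimizer m H := by
  obtain ⟨H, hH, hmax⟩ := exists_max_image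
    ({H | H.Connected ∧ size H = m} : Finset (SimpleGraph V)) (fun H => h 0 H)
    ⟨G, by simp [hG, hs]⟩
  simp only [mem_filter, mem_univ, true_and, and_imp] at hH hmax
  exact ⟨H, (isEntropyMinimizer_iff hm).2 ⟨hH.1, hH.2, hmax⟩⟩

theorem size_induce_of_isUniversal {m : ℕ} {G : SimpleGraph V} {v : V} (hv : G.IsUniversal v) (hs : size G = m) :
    size (G.induce ({v}ᶜ : Set V)) = m + 1 - Fintype.card V := by
  have h1 := size_eq_of_isUniversal hv
  have : 0 < Fintype.card V := Fintype.card_pos_iff.2 ⟨v⟩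
  omega

/-- Any competitor is dominated by some extremal graph, which exists by finiteness. That graph has a
universal vertex, so `h1Max` bounds its `h 0`. -/
theorem isEntropyMinimizer_of_isUniversal {m : ℕ} (hm : 0 < m) (hlow : Fintype.card V ≤ m + 1)
    {G : SimpleGraph V} {v : V} (hv : G.IsUniversal v)
    (hs : size (G.induce ({v}ᶜ : Set V)) = m + 1 - Fintype.card V)
    (hh : h 1 (G.induce ({v}ᶜ : Set V)) = h1Max (m + 1 - Fintype.card V)) :
    IsEntropyMinimizer m G := by
  have hc : 0 < Fintype.card V := Fintype.card_pos_iff.2 ⟨v⟩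
  have hconn : G.Connected := SimpleGraph.Connected.of_isUniversal hv
  have hsize : size G = m := by
    have h1 := size_eq_of_isUniversal hv
    omega
  refine (isEntropyMinimizer_iff hm).2 ⟨hconn, hsize, fun H hH1 hH2 => ?_⟩
  obtain ⟨M, hM⟩ := exists_max_h_zero hm hconn hsize
  refine (((isEntropyMinimizer_iff hm).1 hM).2.2 H hH1 hH2).trans ?_
  obtain ⟨w, hw⟩ := exists_isUniversal_of_isEntropyMinimizer hm hM
  rw [h_zero_eq_of_isUniversal hw, h_zero_eq_of_isUniversal hv, hh,
    ← size_induce_of_isUniversal hw hM.2.1]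
  gcongr
  exact h_one_le_h1Max _

/-- Compares `G` with the cone over a maximizer of `h 1`; `hhigh` makes room for that maximizer on
`n - 1` vertices. -/
theorem h_one_induce_of_isEntropyMinimizer {m : ℕ} (hm : 0 < m) (hlow : Fintype.card V ≤ m + 1)
    {G : SimpleGraph V} {v : V} (hhigh : m + 3 ≤ 2 * Fintype.card V)
    (hG : IsEntropyMinimizer m G) (hv : G.IsUniversal v) :
    h 1 (G.induce ({v}ᶜ : Set V)) = h1Max (m + 1 - Fintype.card V) := by
  obtain ⟨H, hH⟩ := exists_isH1ExtremalForm (V := ({v}ᶜ : Set V)) (a := m + 1 - Fintype.card V)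
    (by rw [card_compl_singleton_set]; omega)
  obtain ⟨h1, h2⟩ := hH.size_eq_and_h_one_eq
  have hU := cone_isUniversal v H
  have hM := isEntropyMinimizer_of_isUniversal hm hlow hU (by rwa [induce_cone])
    (by rwa [induce_cone])
  have h3 := ((isEntropyMinimizer_iff hm).1 hG).2.2 _ hM.1 hM.2.1
  rw [h_zero_eq_of_isUniversal hU, h_zero_eq_of_isUniversal hv, induce_cone, h2] at h3
  have h4 := h_one_le_h1Max (G.induce ({v}ᶜ : Set V))
  rw [size_induce_of_isUniversal hv hG.2.1] at h4
  linarith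

theorem IsUpToIsolated.map_degreeSequence_eq {W : Type*} [Fintype W] {H : SimpleGraph V}
    {P : SimpleGraph W} (hH : IsUpToIsolated H P) : (degreeSequence H).map (· + 1) =
      (degreeSequence P).map (· + 1) +
        Multiset.replicate (Fintype.card V - Fintype.card W) 1 := by
  rw [hH.degreeSequence_eq, Multiset.map_add, Multiset.map_replicate]

/-- Coning raises each degree by one, so the isolated vertices of `H` account for the trailing ones
of the listed sequences. -/
theorem mem_extremalDegreeSequences_iff {n m : ℕ} (hlow : n ≤ m + 1) (hhigh : m + 3 ≤ 2 * n)
    (hV : Fintype.card V = n - 1) {s : Multiset ℕ} :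
    s ∈ extremalDegreeSequences n m ↔ ∃ H : SimpleGraph V, IsH1ExtremalForm (m + 1 - n) H ∧
      s = {n - 1} + (degreeSequence H).map (· + 1) := by
  have pattern : ∀ {W : Type} [Fintype W] (P : SimpleGraph W) (t : Multiset ℕ),
      Fintype.card W ≤ n - 1 → {n - 1} + ((degreeSequence P).map (· + 1) +
        Multiset.replicate (n - 1 - Fintype.card W) 1) = t →
      (s = t ↔ ∃ H : SimpleGraph V, IsUpToIsolated H P ∧
        s = {n - 1} + (degreeSequence H).map (· + 1)) := by
    intro W _ P t hc ht
    constructor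
    · rintro rfl
      obtain ⟨H, hH⟩ := exists_isUpToIsolated (V := V) P (by omega)
      exact ⟨H, hH, by rw [hH.map_degreeSequence_eq, hV, ht]⟩
    · rintro ⟨H, hH, rfl⟩
      rw [hH.map_degreeSequence_eq, hV, ht]
  unfold extremalDegreeSequences
  by_cases e6 : m = n + 5
  · have ha : m + 1 - n = 6 := by omega
    rw [if_pos e6, ha, Set.mem_singleton_iff]
    refine pattern ⊤ _ (by simp; omega) ?_
    simp only [degreeSequence_top, Multiset.map_replicate, add_assoc, Fintype.card_fin,
      Nat.sub_sub, Nat.reduceAdd, Nat.reduceSub]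
  by_cases e5 : m = n + 4
  · have ha : m + 1 - n = 5 := by omega
    rw [if_neg e6, if_pos e5, ha, Set.mem_insert_iff, Set.mem_singleton_iff]
    have hform : ∀ H : SimpleGraph V, IsH1ExtremalForm 5 H ↔
      IsUpToIsolated H K4minus ∨ IsUpToIsolated H (star 5) := fun H => Iff.rfl
    simp only [hform, or_and_right, exists_or]
    refine or_congr (pattern K4minus _ (by simp; omega) ?_) (pattern (star 5) _ (by simp; omega) ?_)
    · simp only [degreeSequence_K4minus, Multiset.map_add, Multiset.map_replicate, add_assoc,
        Fintype.card_fin, Nat.sub_sub, Nat.reduceAdd]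
    · simp only [degreeSequence_star, Multiset.map_add, Multiset.map_singleton,
        Multiset.map_replicate, add_assoc, Fintype.card_sum, Fintype.card_fin, Nat.sub_sub,
        Nat.reduceAdd]
  by_cases e3 : m = n + 2
  · have ha : m + 1 - n = 3 := by omega
    rw [if_neg e6, if_neg e5, if_pos e3, ha, Set.mem_singleton_iff]
    refine pattern ⊤ _ (by simp; omega) ?_
    simp only [degreeSequence_top, Multiset.map_replicate, add_assoc, Fintype.card_fin,
      Nat.sub_sub, Nat.reduceAdd, Nat.reduceSub]
  have hform : ∀ H : SimpleGraph V, IsH1ExtremalForm (m + 1 - n) H ↔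
      IsUpToIsolated H (star (m + 1 - n)) := fun H => by
    rw [IsH1ExtremalForm, if_neg (by omega), if_neg (by omega), if_neg (by omega)]
  simp only [hform]
  rw [if_neg e6, if_neg e5, if_neg e3]
  by_cases e0 : m + 1 = n
  · have ha : m + 1 - n = 0 := by omega
    rw [if_pos e0, Set.mem_singleton_iff, ha]
    refine pattern (star 0) _ (by simp; omega) ?_
    obtain ⟨k, rfl⟩ : ∃ k, n = k + 2 := ⟨n - 2, by omega⟩
    simp [degreeSequence_star, Multiset.replicate_succ]
  · rw [if_neg e0, Set.mem_singleton_iff]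
    refine pattern (star _) _ (by simp; omega) ?_
    have h1 : m + 1 - n + 1 = m + 2 - n := by omega
    have h2 : n - 1 - (1 + (m + 1 - n)) = 2 * n - m - 3 := by omega
    simp only [degreeSequence_star, Multiset.map_add, Multiset.map_singleton,
      Multiset.map_replicate, add_assoc, Fintype.card_sum, Fintype.card_fin, h1, h2,
      Nat.reduceAdd]

end Entropy

end DegreeEntropy

/-! ### The main theorem. -/

theorem theorem3p2 (n m : ℕ) (hlow : n ≤ m + 1) (hhigh : m + 3 ≤ 2 * n)
    {V : Type*} [Fintype V] [DecidableEq V] (hV : Fintype.card V = n) :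
    -- deleting a universal vertex of an extremal graph leaves the `h_1`-maximizer
    (∀ G : SimpleGraph V, DegreeEntropy.IsEntropyMinimizer m G →
      (∃ v : V, G.IsUniversal v) ∧
      ∀ v : V, G.IsUniversal v →
        DegreeEntropy.IsH1Maximizer (m + 1 - n) (G.induce ({v}ᶜ : Set V)) ∧
        DegreeEntropy.IsH1ExtremalForm (m + 1 - n) (G.induce ({v}ᶜ : Set V))) ∧
    -- and each of these properties, as well as the degree sequence, characterizes extremality
    (∀ G : SimpleGraph V,
      (DegreeEntropy.IsEntropyMinimizer m G ↔ ∃ v : V, G.IsUniversal v ∧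
        DegreeEntropy.IsH1Maximizer (m + 1 - n) (G.induce ({v}ᶜ : Set V))) ∧
      (DegreeEntropy.IsEntropyMinimizer m G ↔ ∃ v : V, G.IsUniversal v ∧
        DegreeEntropy.IsH1ExtremalForm (m + 1 - n) (G.induce ({v}ᶜ : Set V))) ∧
      (DegreeEntropy.IsEntropyMinimizer m G ↔
        DegreeEntropy.degreeSequence G ∈ DegreeEntropy.extremalDegreeSequences n m)) ∧
    -- every listed degree sequence occurs
    (∀ s ∈ DegreeEntropy.extremalDegreeSequences n m, ∃ G : SimpleGraph V,
      DegreeEntropy.IsEntropyMinimizer m G ∧ DegreeEntropy.degreeSequence G = s) := by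
  classical
  -- Aligns the given instance with the classical ones used in the lemmas.
  obtain rfl : ‹DecidableEq V› = fun a b => Classical.propDecidable (a = b) :=
    Subsingleton.elim _ _
  subst hV
  have hm : 0 < m := by omega
  have hne : ∀ v : V, Nonempty ({v}ᶜ : Set V) := fun v => by
    rw [← Fintype.card_pos_iff, DegreeEntropy.card_compl_singleton_set]; omega
  have necessary : ∀ G : SimpleGraph V, DegreeEntropy.IsEntropyMinimizer m G →
      ∀ v : V, G.IsUniversal v →
        DegreeEntropy.IsH1Maximizer (m + 1 - Fintype.card V) (G.induce ({v}ᶜ : Set V)) ∧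
        DegreeEntropy.IsH1ExtremalForm (m + 1 - Fintype.card V) (G.induce ({v}ᶜ : Set V)) := by
    intro G hG v hv
    have hmax := And.intro (DegreeEntropy.size_induce_of_isUniversal hv hG.2.1)
      (DegreeEntropy.h_one_induce_of_isEntropyMinimizer hm hlow hhigh hG hv)
    have := hne v
    exact ⟨DegreeEntropy.isH1Maximizer_iff.2 hmax, DegreeEntropy.isH1ExtremalForm_iff.2 hmax⟩
  have exists_universal : ∀ G : SimpleGraph V, DegreeEntropy.IsEntropyMinimizer m G →
      ∃ v, G.IsUniversal v := fun G hG =>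
    DegreeEntropy.exists_isUniversal_of_isEntropyMinimizer hm hG
  have sufficient : ∀ (G : SimpleGraph V) (v : V), G.IsUniversal v →
      DegreeEntropy.IsH1Maximizer (m + 1 - Fintype.card V) (G.induce ({v}ᶜ : Set V)) →
      DegreeEntropy.IsEntropyMinimizer m G := by
    intro G v hv hG
    obtain ⟨h1, h2⟩ := DegreeEntropy.isH1Maximizer_iff.1 hG
    exact DegreeEntropy.isEntropyMinimizer_of_isUniversal hm hlow hv h1 h2
  have sufficient' : ∀ (G : SimpleGraph V) (v : V), G.IsUniversal v →
      DegreeEntropy.IsH1ExtremalForm (m + 1 - Fintype.card V) (G.induce ({v}ᶜ : Set V)) →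
      DegreeEntropy.IsEntropyMinimizer m G := by
    intro G v hv hG
    exact sufficient G v hv (DegreeEntropy.isH1Maximizer_iff.2 hG.size_eq_and_h_one_eq)
  have mem_iff := fun (v : V) (s : Multiset ℕ) =>
    DegreeEntropy.mem_extremalDegreeSequences_iff (s := s) hlow hhigh
      (DegreeEntropy.card_compl_singleton_set v)
  refine ⟨fun G hG => ⟨exists_universal G hG, necessary G hG⟩, fun G => ⟨⟨fun hG => ?_, ?_⟩,
    ⟨fun hG => ?_, ?_⟩, ⟨fun hG => ?_, fun hG => ?_⟩⟩, fun s hs => ?_⟩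
  · obtain ⟨v, hv⟩ := exists_universal G hG
    exact ⟨v, hv, (necessary G hG v hv).1⟩
  · rintro ⟨v, hv, hG⟩
    exact sufficient G v hv hG
  · obtain ⟨v, hv⟩ := exists_universal G hG
    exact ⟨v, hv, (necessary G hG v hv).2⟩
  · rintro ⟨v, hv, hG⟩
    exact sufficient' G v hv hG
  · obtain ⟨v, hv⟩ := exists_universal G hG
    exact (mem_iff v _).2 ⟨_, (necessary G hG v hv).2,
      DegreeEntropy.degreeSequence_eq_of_isUniversal hv⟩
  · obtain ⟨v₀⟩ : Nonempty V := Fintype.card_pos_iff.1 (by omega)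
    obtain ⟨_, _, hs₀⟩ := (mem_iff v₀ _).1 hG
    -- The entry `n - 1` yields a universal vertex. Cancelling it leaves the degree sequence of a
    -- maximizer, and `h 1` and the size depend on that sequence alone.
    obtain ⟨v, -, hv⟩ := Multiset.mem_map.1
      (show Fintype.card V - 1 ∈ DegreeEntropy.degreeSequence G by rw [hs₀]; simp)
    have hU := DegreeEntropy.isUniversal_of_degree hv
    obtain ⟨H, hH, hs⟩ := (mem_iff v _).1 hG
    rw [DegreeEntropy.degreeSequence_eq_of_isUniversal hU] at hs
    have hds := Multiset.map_injective (add_left_injective 1) (add_left_cancel hs)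
    obtain ⟨h1, h2⟩ := hH.size_eq_and_h_one_eq
    have h3 := DegreeEntropy.sum_degreeSequence (G.induce ({v}ᶜ : Set V))
    rw [hds, DegreeEntropy.sum_degreeSequence] at h3
    refine DegreeEntropy.isEntropyMinimizer_of_isUniversal hm hlow hU (by omega) ?_
    rw [DegreeEntropy.h_eq_sum_degreeSequence, hds, ← DegreeEntropy.h_eq_sum_degreeSequence, h2]
  · obtain ⟨v⟩ : Nonempty V := Fintype.card_pos_iff.1 (by omega)
    obtain ⟨H, hH, rfl⟩ := (mem_iff v _).1 hs
    have hU := DegreeEntropy.cone_isUniversal v H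
    refine ⟨DegreeEntropy.cone v H, sufficient' _ v hU ?_, ?_⟩
    · rwa [DegreeEntropy.induce_cone]
    · rw [DegreeEntropy.degreeSequence_eq_of_isUniversal hU, DegreeEntropy.induce_cone]
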